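/- **Lemma (Negative eigenvalues).** For measurable $V:\mathbb{R}^3\to\mathbb{R}$ put $\|V\|_{\mathcal K}:=\sup_{x\in\mathbb{R}^3}\int_{\mathbb{R}^3}\frac{|V(y)|}{|x-y|}\,dy$, and let $\mathcal{K}_0$ be the closure, in this norm, of the set of bounded compactly supported real-valued functions on $\mathbb{R}^3$. For $V\in\mathcal{K}_0$ let $\mathcal{H}=-\Delta+V$ be the operator on $L^2(\mathbb{R}^3;\mathbb{C})$ of the quadratic form $\int\nabla u\cdot\overline{\nabla v}\,dx+\int V u\overline{v}\,dx$ with form domain $H^1(\mathbb{R}^3)$; that is, $u$ is in the domain of $\mathcal{H}$ and $\mathcal{H}u=f\in L^2$ if and only if $u\in H^1$ and $\int\nabla u\cdot\overline{\nabla v}\,dx+\int Vu\overline{v}\,dx=\int f\overline{v}\,dx$ for all $v\in H^1$. For $f\in L^1(\mathbb{R}^3;\mathbb{C})$ let $(R_0(0)f)(x)=\int_{\mathbb{R}^3}\frac{f(y)}{4\pi|x-y|}\,dy$. If $V\in\mathcal{K}_0$ and zero is not a resonance of $\mathcal{H}$, i.e. $I+VR_0(0)$ is invertible in the algebra $\mathcal{L}(L^1)$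 of bounded linear operators on $L^1(\mathbb{R}^3;\mathbb{C})$, then $\mathcal{H}$ has at most finitely many negative eigenvalues, each of finite multiplicity. -/

import Mathlib

open MeasureTheory
open scoped ENNReal ContDiff InnerProductSpace

namespace SchrodingerKato

noncomputable section

/-- Euclidean three-space. -/
abbrev R3 : Type := EuclideanSpace ℝ (Fin 3)

/-- Complex `L¹(ℝ³)`. -/
abbrev L1 : Type := Lp ℂ 1 (volume : Measure R3)

/-- Complex `L²(ℝ³)`. -/
abbrev L2 : Type := Lp ℂ 2 (volume : Measure R3)

/-! ### The potential class -/

/-- The global Kato norm `sup_x ∫ |V(y)| / |x - y| dy`, with values in `[0, ∞]`.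
(The value of the integrand at the single point `y = x` is irrelevant.) -/
def globalKatoNorm (V : R3 → ℝ) : ℝ≥0∞ :=
  ⨆ x : R3, ∫⁻ y : R3, ‖V y‖ₑ / ‖x - y‖ₑ

/-- The set `C_c^b` of bounded, compactly supported (measurable) real functions. -/
def IsBoundedCompactlySupported (W : R3 → ℝ) : Prop :=
  AEMeasurable W ∧ (∃ C : ℝ, ∀ x, |W x| ≤ C) ∧ HasCompactSupport W

/-- The class `𝒦₀`: the closure of `C_c^b` in the global Kato norm. The norm of such a `V`
is finite, because bounded functions of compact support have finite norm. -/
def MemKatoZero (V : R3 → ℝ) : Prop :=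
  AEMeasurable V ∧
    ∀ ε : ℝ≥0∞, 0 < ε →
      ∃ W : R3 → ℝ, IsBoundedCompactlySupported W ∧ globalKatoNorm (V - W) < ε

/-! ### Resonances -/

/-- The kernel `e^{-√(-z) r} / (4 π r)`, `r = |x - y|`, of the free resolvent
`R₀(z) = (-Δ - z)⁻¹`. The principal branch has `Re √(-z) > 0` for `z ∉ [0, ∞)`. At `z = 0` this is
the Newton kernel `1 / (4 π r)`, and for `z > 0` it is one of the two boundary values. -/
def freeResolventKernel (z : ℂ) (x y : R3) : ℂ :=
  Complex.exp (-((-z) ^ (1 / 2 : ℂ) * (‖x - y‖ : ℂ))) / (4 * Real.pi * ‖x - y‖ : ℝ)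

/-- The free resolvent `(R₀(z) f)(x) = ∫ e^{-√(-z)|x-y|} / (4π|x-y|) f(y) dy`. -/
def freeResolvent (z : ℂ) (f : R3 → ℂ) (x : R3) : ℂ :=
  ∫ y : R3, freeResolventKernel z x y * f y

/-- `I + V R₀(z)` is (given by) an invertible element of the algebra of bounded linear operators
on `L¹`. -/
def IsInvertibleOnL1 (V : R3 → ℝ) (z : ℂ) : Prop :=
  ∃ A : L1 →L[ℂ] L1,
    (∀ f : L1, ∀ᵐ x : R3, A f x = f x + (V x : ℂ) * freeResolvent z f x) ∧ IsUnit A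

/-- `z` is a resonance of `-Δ + V` if `I + V R₀(z)` is not invertible on `L¹`. -/
def IsResonance (V : R3 → ℝ) (z : ℂ) : Prop :=
  ¬ IsInvertibleOnL1 V z

/-! ### The Sobolev space `H¹` through weak derivatives -/

/-- `G = (G₀, G₁, G₂) ∈ (L²)³` is the weak gradient of `u ∈ L²`. So `u ∈ H¹` if and only if
`u` has such a `G`. -/
def HasWeakGradient (u : L2) (G : Fin 3 → L2) : Prop :=
  ∀ i : Fin 3, ∀ φ : R3 → ℝ, ContDiff ℝ ∞ φ → HasCompactSupport φ →
    ∫ x, fderiv ℝ φ x (EuclideanSpace.single i 1) • u x = - ∫ x, φ x • G i x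

lemma integrable_smul_L2 {φ : R3 → ℝ} (hφ : Continuous φ) (hs : HasCompactSupport φ) (u : L2) :
    Integrable (fun x => φ x • u x) := by
  have h := (Lp.memLp u).locallyIntegrable (by norm_num)
  exact h.integrable_smul_left_of_hasCompactSupport hφ hs

lemma continuous_fderiv_apply' {φ : R3 → ℝ} (hφ : ContDiff ℝ ∞ φ) (v : R3) :
    Continuous fun x => fderiv ℝ φ x v :=
  (hφ.continuous_fderiv (by simp)).clm_apply continuous_const

lemma HasWeakGradient.add {u v : L2} {G K : Fin 3 → L2}
    (hu : HasWeakGradient u G) (hv : HasWeakGradient v K) : HasWeakGradient (u + v) (G + K) := by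
  intro i φ hφ hs
  have hs' := hs.fderiv_apply (𝕜 := ℝ) (EuclideanSpace.single i (1 : ℝ))
  have hc' := continuous_fderiv_apply' hφ (EuclideanSpace.single i (1 : ℝ))
  have e1 : ∫ x, fderiv ℝ φ x (EuclideanSpace.single i 1) • (u + v : L2) x
      = ∫ x, (fderiv ℝ φ x (EuclideanSpace.single i 1) • u x
        + fderiv ℝ φ x (EuclideanSpace.single i 1) • v x) := by
    apply integral_congr_ae
    filter_upwards [Lp.coeFn_add u v] with x hx
    rw [hx, Pi.add_apply, smul_add]
  have e2 : ∫ x, φ x • ((G + K) i : L2) x = ∫ x, (φ x • G i x + φ x • K i x) := by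
    apply integral_congr_ae
    filter_upwards [Lp.coeFn_add (G i) (K i)] with x hx
    rw [Pi.add_apply, hx, Pi.add_apply, smul_add]
  rw [e1, e2, integral_add (integrable_smul_L2 hc' hs' u) (integrable_smul_L2 hc' hs' v),
    integral_add (integrable_smul_L2 hφ.continuous hs _) (integrable_smul_L2 hφ.continuous hs _),
    hu i φ hφ hs, hv i φ hφ hs]
  ring

lemma HasWeakGradient.smul {u : L2} {G : Fin 3 → L2} (c : ℂ)
    (hu : HasWeakGradient u G) : HasWeakGradient (c • u) (c • G) := by
  intro i φ hφ hs
  have e1 : ∫ x, fderiv ℝ φ x (EuclideanSpace.single i 1) • (c • u : L2) x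
      = ∫ x, c • (fderiv ℝ φ x (EuclideanSpace.single i 1) • u x) := by
    apply integral_congr_ae
    filter_upwards [Lp.coeFn_smul c u] with x hx
    rw [hx, Pi.smul_apply, smul_comm]
  have e2 : ∫ x, φ x • ((c • G) i : L2) x = ∫ x, c • (φ x • G i x) := by
    apply integral_congr_ae
    filter_upwards [Lp.coeFn_smul c (G i)] with x hx
    rw [Pi.smul_apply, hx, Pi.smul_apply, smul_comm]
  rw [e1, e2, integral_smul, integral_smul, hu i φ hφ hs, smul_neg]

lemma HasWeakGradient.zero : HasWeakGradient 0 0 := by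
  simpa using (HasWeakGradient.smul (0 : ℂ) (u := 0) (G := 0) (by
    intro i φ hφ hs
    have e : ∀ g : R3 → ℝ, ∫ x, g x • (0 : L2) x = 0 := by
      intro g
      refine integral_eq_zero_of_ae ?_
      filter_upwards with x
      simp
    rw [e]
    simp only [Pi.zero_apply]
    rw [e, neg_zero]))

/-- An element of `L²` that is orthogonal to all test functions vanishes. -/
lemma eq_zero_of_test {f : L2}
    (h : ∀ φ : R3 → ℝ, ContDiff ℝ ∞ φ → HasCompactSupport φ → ∫ x, φ x • f x = 0) : f = 0 := by
  have h1 := ae_eq_zero_of_integral_contDiff_smul_eq_zero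
    ((Lp.memLp f).locallyIntegrable (by norm_num)) h
  exact Lp.eq_zero_iff_ae_eq_zero.mpr h1

lemma HasWeakGradient.eq_zero {G : Fin 3 → L2} (h : HasWeakGradient 0 G) : G = 0 := by
  funext i
  refine eq_zero_of_test fun φ hφ hs => ?_
  have h1 := h i φ hφ hs
  have h2 := HasWeakGradient.zero i φ hφ hs
  rw [h1] at h2
  rw [neg_inj] at h2
  rw [h2]
  refine integral_eq_zero_of_ae ?_
  filter_upwards with x
  simp

/-! ### The Schrödinger operator -/

/-- `H u = f` in the sense of the quadratic form `q` of `-Δ + V` with form domain `H¹`: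
`u ∈ H¹`, and `∫ ∇u · conj ∇v + ∫ V u conj v = ∫ f conj v` for all `v ∈ H¹`
(`⟪v, f⟫_ℂ` is `∫ f conj v`). -/
def SchrodingerEq (V : R3 → ℝ) (u f : L2) : Prop :=
  ∃ G : Fin 3 → L2, HasWeakGradient u G ∧
    ∀ (v : L2) (K : Fin 3 → L2), HasWeakGradient v K →
      Integrable (fun x : R3 => (V x : ℂ) * u x * starRingEnd ℂ (v x)) ∧
      ∑ i, ⟪K i, G i⟫_ℂ + ∫ x : R3, (V x : ℂ) * u x * starRingEnd ℂ (v x) = ⟪v, f⟫_ℂ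

/-- The graph of the Schrödinger operator, `{(u, f) | H u = f}`. -/
def schrodingerGraph (V : R3 → ℝ) : Submodule ℂ (L2 × L2) where
  carrier := {p | SchrodingerEq V p.1 p.2}
  zero_mem' := by
    refine ⟨0, HasWeakGradient.zero, fun v K _ => ?_⟩
    have e : (fun x : R3 => (V x : ℂ) * (0 : L2) x * starRingEnd ℂ (v x)) =ᵐ[volume] 0 := by
      filter_upwards with x
      simp
    refine ⟨(integrable_congr e).mpr (integrable_zero _ _ _), ?_⟩
    simp only [Prod.fst_zero, Prod.snd_zero]
    rw [integral_eq_zero_of_ae e]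
    simp
  add_mem' := by
    rintro ⟨u, f⟩ ⟨u', f'⟩ ⟨G, hG, h⟩ ⟨G', hG', h'⟩
    refine ⟨G + G', hG.add hG', fun v K hK => ?_⟩
    obtain ⟨i1, e1⟩ := h v K hK
    obtain ⟨i2, e2⟩ := h' v K hK
    simp only [Prod.mk_add_mk] at *
    have e : (fun x : R3 => (V x : ℂ) * (u + u' : L2) x * starRingEnd ℂ (v x)) =ᵐ[volume]
        fun x => (V x : ℂ) * u x * starRingEnd ℂ (v x)
          + (V x : ℂ) * u' x * starRingEnd ℂ (v x) := by
      filter_upwards [Lp.coeFn_add u u'] with x hx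
      rw [hx, Pi.add_apply]
      ring
    refine ⟨(integrable_congr e).mpr (i1.add i2), ?_⟩
    rw [integral_congr_ae e, integral_add i1 i2, inner_add_right, ← e1, ← e2]
    simp only [Pi.add_apply, inner_add_right, Finset.sum_add_distrib]
    ring
  smul_mem' := by
    rintro c ⟨u, f⟩ ⟨G, hG, h⟩
    refine ⟨c • G, hG.smul c, fun v K hK => ?_⟩
    obtain ⟨i1, e1⟩ := h v K hK
    simp only [Prod.smul_mk] at *
    have e : (fun x : R3 => (V x : ℂ) * (c • u : L2) x * starRingEnd ℂ (v x)) =ᵐ[volume]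
        fun x => c * ((V x : ℂ) * u x * starRingEnd ℂ (v x)) := by
      filter_upwards [Lp.coeFn_smul c u] with x hx
      rw [hx, Pi.smul_apply, smul_eq_mul]
      ring
    refine ⟨(integrable_congr e).mpr (i1.const_mul c), ?_⟩
    rw [integral_congr_ae e, integral_const_mul, inner_smul_right, ← e1]
    simp only [Pi.smul_apply, inner_smul_right, ← Finset.mul_sum]
    ring

/-- A real test function, as an element of `L²`, with its gradient. -/
lemma exists_test_L2 {φ : R3 → ℝ} (hφ : ContDiff ℝ ∞ φ) (hs : HasCompactSupport φ) :
    ∃ (v : L2) (K : Fin 3 → L2), HasWeakGradient v K ∧ ∀ᵐ x, v x = (φ x : ℂ) := by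
  have mem : ∀ g : R3 → ℝ, Continuous g → HasCompactSupport g →
      MemLp (fun x => (g x : ℂ)) 2 (volume : Measure R3) := fun g hg hgs =>
    (hg.memLp_of_hasCompactSupport hgs).ofReal
  have hc' := fun i : Fin 3 => continuous_fderiv_apply' hφ (EuclideanSpace.single i (1 : ℝ))
  have hs' := fun i : Fin 3 => hs.fderiv_apply (𝕜 := ℝ) (EuclideanSpace.single i (1 : ℝ))
  refine ⟨(mem φ hφ.continuous hs).toLp, fun i => (mem _ (hc' i) (hs' i)).toLp, ?_,
    MemLp.coeFn_toLp _⟩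
  intro i η hη hηs
  have hcη := continuous_fderiv_apply' hη (EuclideanSpace.single i (1 : ℝ))
  have e1 : ∫ x, fderiv ℝ η x (EuclideanSpace.single i 1) • ((mem φ hφ.continuous hs).toLp : L2) x
      = ∫ x, ((φ x * fderiv ℝ η x (EuclideanSpace.single i 1) : ℝ) : ℂ) := by
    apply integral_congr_ae
    filter_upwards [MemLp.coeFn_toLp (mem φ hφ.continuous hs)] with x hx
    rw [hx, Complex.real_smul]
    push_cast
    ring
  have e2 : ∫ x, η x • ((mem _ (hc' i) (hs' i)).toLp : L2) x
      = ∫ x, ((fderiv ℝ φ x (EuclideanSpace.single i 1) * η x : ℝ) : ℂ) := by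
    apply integral_congr_ae
    filter_upwards [MemLp.coeFn_toLp (mem _ (hc' i) (hs' i))] with x hx
    rw [hx, Complex.real_smul]
    push_cast
    ring
  rw [e1, e2, integral_complex_ofReal, integral_complex_ofReal,
    integral_mul_fderiv_eq_neg_fderiv_mul_of_integrable
      (((hc' i).mul hη.continuous).integrable_of_hasCompactSupport (hηs.mul_left))
      ((hφ.continuous.mul hcη).integrable_of_hasCompactSupport (hs.mul_right))
      ((hφ.continuous.mul hη.continuous).integrable_of_hasCompactSupport (hs.mul_right))
      (fun x _ => hφ.differentiable (by simp) x) (fun x _ => hη.differentiable (by simp) x)]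
  push_cast
  rfl

/-- The graph is single-valued, so that the operator below is well defined. -/
lemma schrodingerGraph_singleValued (V : R3 → ℝ) :
    ∀ p ∈ schrodingerGraph V, p.1 = 0 → p.2 = 0 := by
  rintro ⟨u, f⟩ ⟨G, hG, h⟩ hu
  simp only at hG h hu ⊢
  subst hu
  obtain rfl := hG.eq_zero
  refine eq_zero_of_test fun φ hφ hs => ?_
  obtain ⟨v, K, hK, hv⟩ := exists_test_L2 hφ hs
  obtain ⟨-, e⟩ := h v K hK
  have e0 : (fun x : R3 => (V x : ℂ) * (0 : L2) x * starRingEnd ℂ (v x)) =ᵐ[volume] 0 := by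
    filter_upwards with x
    simp
  rw [integral_eq_zero_of_ae e0] at e
  simp only [Pi.zero_apply, inner_zero_right, Finset.sum_const_zero, add_zero] at e
  rw [L2.inner_def] at e
  rw [e]
  apply integral_congr_ae
  filter_upwards [hv] with x hx
  simp [hx, mul_comm]

/-- The Schrödinger operator `H = -Δ + V` on `L²`, with domain
`{u ∈ H¹ | (-Δ + V) u ∈ L²}`: the operator of the quadratic form `q`. -/
def schrodingerOperator (V : R3 → ℝ) : L2 →ₗ.[ℂ] L2 :=
  (schrodingerGraph V).toLinearPMap

/-- `H u = f` means what it should. -/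
lemma mem_graph_schrodingerOperator (V : R3 → ℝ) (u f : L2) :
    (u, f) ∈ (schrodingerOperator V).graph ↔ SchrodingerEq V u f := by
  rw [schrodingerOperator,
    Submodule.toLinearPMap_graph_eq _ (schrodingerGraph_singleValued V)]
  rfl

/-- The eigenspace `{ψ ∈ D(T) | T ψ = μ ψ}` of a partially defined operator `T`. -/
def eigenspace (T : L2 →ₗ.[ℂ] L2) (μ : ℂ) : Submodule ℂ T.domain :=
  LinearMap.ker (T.toFun - μ • T.domain.subtype)

/-- `μ` is an eigenvalue of `T` if its eigenspace is not zero. -/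
def IsEigenvalue (T : L2 →ₗ.[ℂ] L2) (μ : ℂ) : Prop :=
  eigenspace T μ ≠ ⊥

end

end SchrodingerKato

/-! On a subspace of $H^1$ of finite codimension the quadratic form is nonnegative, and a span of
eigenfunctions with negative eigenvalues can meet such a subspace only in zero.

To find the subspace, write $V=(V-W)+W$ with $W$ bounded of compact support and $V-W$ small in the
Kato norm. Kato's inequality $\int w|u|^2\le C\|w\|_{\mathcal K}\int|\nabla u|^2$ bounds the energy
of $V-W$ by a quarter of the kinetic energy. Cover the support of $W$ by finitely many small cubes:
if $u$ has mean zero on each, Poincaré's inequality bounds the energy of $W$ by another quarter.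
Hence the form is at least $\frac12\int|\nabla u|^2$ under finitely many linear conditions
(`MemKatoZero.exists_form_bound`). Eigenfunctions to different eigenvalues are orthogonal, so for a
sum of eigenfunctions with distinct negative eigenvalues the form is $\sum_i l_i\|\psi_i\|^2$. If
all averages of the sum vanish, this is also nonnegative, and every $\psi_i$ is zero
(`eigenfunctions_eq_zero`). The averaging map thus embeds each negative eigenspace in a
finite-dimensional space and sends eigenfunctions to distinct negative eigenvalues to independent
vectors.

Kato's inequality rests on $|u|\le C\,|x|^{-2}*|\nabla u|$ and on the boundedness of this Riesz
potential from $L^2$ to $L^2(w)$. By duality the latter reduces to the composition of the kernel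
with itself, which the Newton kernel dominates (`exists_riesz_comp_le`), and the Kato norm is
exactly what a Schur test for the Newton kernel needs. Both inequalities are proved for $C^1$
functions and carried to $H^1$ by Fatou's lemma; hence `exists_smooth_approx` asks only for
convergence almost everywhere and an asymptotic upper bound on the Dirichlet integrals. -/

namespace SchrodingerKato

/-! ### Composition of Riesz kernels -/

/-- Cauchy-Schwarz for `[0, ∞]`-valued functions, with squares. -/
theorem sq_lintegral_mul_le {α : Type*} [MeasurableSpace α] {μ : Measure α} {f g : α → ℝ≥0∞}
    (hf : AEMeasurable f μ) (hg : AEMeasurable g μ) :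
    (∫⁻ a, f a * g a ∂μ) ^ 2 ≤ (∫⁻ a, f a ^ 2 ∂μ) * ∫⁻ a, g a ^ 2 ∂μ := by
  have h := ENNReal.lintegral_mul_le_Lp_mul_Lq μ Real.HolderConjugate.two_two hf hg
  simp only [Pi.mul_apply, ENNReal.rpow_two] at h
  have e : ∀ a : ℝ≥0∞, (a ^ (1 / 2 : ℝ)) ^ 2 = a := fun a => by
    rw [← ENNReal.rpow_natCast, ← ENNReal.rpow_mul]
    norm_num
  calc (∫⁻ a, f a * g a ∂μ) ^ 2 ≤ _ := pow_le_pow_left' h 2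
    _ = _ := by rw [mul_pow, e, e]

theorem lintegral_smul_scale (f : R3 → ℝ≥0∞) {r : ℝ} (hr : r ≠ 0) :
    ∫⁻ x, f (r • x) = ENNReal.ofReal |(r ^ 3)⁻¹| * ∫⁻ x, f x := by
  have h := Measure.map_addHaar_smul (volume : Measure R3) hr
  have h2 := (Homeomorph.smulOfNeZero r hr : R3 ≃ₜ R3).measurableEmbedding.lintegral_map
    (μ := volume) f
  simp only [Homeomorph.smulOfNeZero_apply] at h2
  rw [← h2]
  change ∫⁻ a, f a ∂(Measure.map (r • ·) volume) = _
  rw [h, lintegral_smul_measure]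
  simp

/-- The part of the kernel `|x|⁻² |x - y|⁻²` near `0`, where `|x - y| ≥ max s |x|`,
`s = |y| / 2`. -/
noncomputable def cutKernel (s : ℝ) (x : R3) : ℝ≥0∞ :=
  (‖x‖ₑ⁻¹) ^ 2 * ((max (ENNReal.ofReal s) ‖x‖ₑ)⁻¹) ^ 2

theorem measurable_cutKernel (s : ℝ) : Measurable (cutKernel s) := by
  unfold cutKernel
  fun_prop

/-- In polar coordinates the Jacobian $t^2$ cancels the singularity at the origin and leaves
$\max(1,t)^{-2}$, which is integrable on the half-line. -/
theorem lintegral_cutKernel_one_lt_top : ∫⁻ x, cutKernel 1 x < ⊤ := by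
  have key : Integrable (fun x : R3 => (fun t : ℝ => (t⁻¹) ^ 2 * ((max 1 t)⁻¹) ^ 2) ‖x‖) := by
    refine (integrable_fun_norm_addHaar (E := R3) volume
      (f := fun t : ℝ => (t⁻¹) ^ 2 * ((max 1 t)⁻¹) ^ 2)).mpr ?_
    have hd : Module.finrank ℝ R3 - 1 = 2 := by simp
    rw [hd]
    have h1 : IntegrableOn (fun t : ℝ => ((max 1 t)⁻¹) ^ 2) (Set.Ioi 0) := by
      rw [← Set.Ioc_union_Ioi_eq_Ioi (zero_le_one (α := ℝ)), integrableOn_union]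
      constructor
      · apply Continuous.integrableOn_Ioc
        refine Continuous.pow (Continuous.inv₀ (by fun_prop) fun x => ?_) 2
        positivity
      · have := integrableOn_Ioi_rpow_of_lt (a := -2) (by norm_num) (zero_lt_one (α := ℝ))
        refine this.congr_fun (fun t ht => ?_) measurableSet_Ioi
        have ht' : (1 : ℝ) < t := ht
        simp only
        rw [max_eq_right ht'.le, inv_pow, Real.rpow_neg (by linarith), Real.rpow_two]
    refine h1.congr_fun (fun t ht => ?_) measurableSet_Ioi
    have ht' : (0 : ℝ) < t := ht
    simp only [smul_eq_mul]
    field_simp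
  have h2 := key.2
  rw [hasFiniteIntegral_iff_enorm] at h2
  refine lt_of_le_of_lt (lintegral_mono_ae ?_) h2
  filter_upwards [(measure_eq_zero_iff_ae_notMem.mp (measure_singleton (0 : R3)))] with x hx
  have hx' : 0 < ‖x‖ := norm_pos_iff.mpr (by simpa using hx)
  unfold cutKernel
  rw [← ofReal_norm, ← ofReal_norm, ← ENNReal.ofReal_max,
    ← ENNReal.ofReal_inv_of_pos hx', ← ENNReal.ofReal_inv_of_pos (by positivity),
    ← ENNReal.ofReal_pow (by positivity), ← ENNReal.ofReal_pow (by positivity),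
    ← ENNReal.ofReal_mul (by positivity), Real.norm_of_nonneg (by positivity)]

/-- Scaling: the kernel is homogeneous of degree $-4$ in $(s,x)$ jointly, and the Jacobian
contributes $s^3$. -/
theorem lintegral_cutKernel {s : ℝ} (hs : 0 < s) :
    ∫⁻ x, cutKernel s x = (ENNReal.ofReal s)⁻¹ * ∫⁻ x, cutKernel 1 x := by
  have h := lintegral_smul_scale (cutKernel s) hs.ne'
  have hs0 : ENNReal.ofReal s ≠ 0 := by simpa using hs
  have e : ∀ x : R3, cutKernel s (s • x) = ((ENNReal.ofReal s)⁻¹) ^ 4 * cutKernel 1 x := by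
    intro x
    unfold cutKernel
    rw [enorm_smul, Real.enorm_eq_ofReal hs.le]
    have e1 : max (ENNReal.ofReal s) (ENNReal.ofReal s * ‖x‖ₑ)
        = ENNReal.ofReal s * max (ENNReal.ofReal 1) ‖x‖ₑ := by
      rw [mul_max]; simp
    rw [e1, ENNReal.mul_inv (Or.inl hs0) (Or.inl ENNReal.ofReal_ne_top),
      ENNReal.mul_inv (Or.inl hs0) (Or.inl ENNReal.ofReal_ne_top)]
    ring
  simp_rw [e] at h
  rw [lintegral_const_mul _ (measurable_cutKernel 1), abs_of_pos (by positivity),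
    ENNReal.ofReal_inv_of_pos (by positivity), ENNReal.ofReal_pow hs.le] at h
  set a := ENNReal.ofReal s with ha
  have hat : a ≠ ⊤ := ENNReal.ofReal_ne_top
  have h3 : a * a⁻¹ = 1 := ENNReal.mul_inv_cancel hs0 hat
  have h4 : a ^ 3 * (a ^ 3)⁻¹ = 1 := ENNReal.mul_inv_cancel (by simp [hs0]) (by simp [hat])
  calc ∫⁻ x, cutKernel s x = (a ^ 3 * (a ^ 3)⁻¹) * ∫⁻ x, cutKernel s x := by rw [h4, one_mul]
    _ = a ^ 3 * ((a⁻¹) ^ 4 * ∫⁻ x, cutKernel 1 x) := by rw [h]; ring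
    _ = (a * a⁻¹) ^ 3 * (a⁻¹ * ∫⁻ x, cutKernel 1 x) := by ring
    _ = _ := by rw [h3]; ring

/-- The composition of two Riesz kernels `|x|⁻²` on `ℝ³` is bounded by a Newton kernel. -/
theorem exists_riesz_comp_le :
    ∃ C : ℝ≥0∞, C ≠ 0 ∧ C ≠ ⊤ ∧ ∀ x y : R3,
      ∫⁻ z, (‖x - z‖ₑ⁻¹) ^ 2 * (‖y - z‖ₑ⁻¹) ^ 2 ≤ C * ‖x - y‖ₑ⁻¹ := by
  -- Two halves, each with $s^{-1}=2|x-y|^{-1}$, give the factor 4. The summand 1 makes the constant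
  -- nonzero, so that the right-hand side is `⊤` on the diagonal.
  refine ⟨4 * (∫⁻ x, cutKernel 1 x) + 1, by simp, ?_, fun x y => ?_⟩
  · exact ENNReal.add_ne_top.mpr
      ⟨ENNReal.mul_ne_top (by norm_num) lintegral_cutKernel_one_lt_top.ne, ENNReal.one_ne_top⟩
  rcases eq_or_ne x y with rfl | hxy
  · simp [ENNReal.mul_top]
  have hr : 0 < ‖x - y‖ := norm_pos_iff.mpr (sub_ne_zero.mpr hxy)
  set s := ‖x - y‖ / 2 with hs
  have hs0 : 0 < s := by positivity
  -- If $z$ is at least as near to $a$ as to $b$, then $|a-b|\le 2|b-z|$, so $|b-z|$ dominates both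
  -- $s$ and $|a-z|$.
  have key : ∀ a b : R3, ‖a - b‖ = ‖x - y‖ → ∀ z, ‖a - z‖ ≤ ‖b - z‖ →
      (‖a - z‖ₑ⁻¹) ^ 2 * (‖b - z‖ₑ⁻¹) ^ 2 ≤ cutKernel s (a - z) := by
    intro a b hab z h
    unfold cutKernel
    refine mul_le_mul_right (pow_le_pow_left' (ENNReal.inv_le_inv.mpr (max_le ?_ ?_)) 2) _
    · rw [← ofReal_norm]
      apply ENNReal.ofReal_le_ofReal
      have : ‖a - b‖ ≤ ‖a - z‖ + ‖b - z‖ := by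
        rw [norm_sub_rev b z]; exact norm_sub_le_norm_sub_add_norm_sub a z b
      linarith
    · rw [← ofReal_norm, ← ofReal_norm]
      exact ENNReal.ofReal_le_ofReal h
  have hpt : ∀ z, (‖x - z‖ₑ⁻¹) ^ 2 * (‖y - z‖ₑ⁻¹) ^ 2
      ≤ cutKernel s (x - z) + cutKernel s (y - z) := by
    intro z
    rcases le_total ‖x - z‖ ‖y - z‖ with h | h
    · exact (key x y rfl z h).trans le_self_add
    · rw [mul_comm]
      exact (key y x (norm_sub_rev y x) z h).trans le_add_self
  have hm := measurable_cutKernel s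
  calc _ ≤ ∫⁻ z, cutKernel s (x - z) + cutKernel s (y - z) := lintegral_mono hpt
    _ = 2 * ∫⁻ z, cutKernel s z := by
      rw [lintegral_add_left (by fun_prop), lintegral_sub_left_eq_self,
        lintegral_sub_left_eq_self, two_mul]
    _ = 4 * (∫⁻ x, cutKernel 1 x) * ‖x - y‖ₑ⁻¹ := by
      rw [lintegral_cutKernel hs0, hs, ENNReal.ofReal_div_of_pos two_pos, ofReal_norm,
        ENNReal.inv_div (by simp) (by simp), div_eq_mul_inv, ENNReal.ofReal_ofNat]
      ring
    _ ≤ _ := by gcongr; exact le_self_add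

/-! ### Pointwise bound by the Riesz potential of the gradient -/

/-- A function of compact support is controlled by its derivative along a ray. -/
theorem enorm_le_lintegral_ray {u : R3 → ℂ} (hu : ContDiff ℝ 1 u) (hs : HasCompactSupport u)
    (x : R3) {v : R3} (hv : v ≠ 0) :
    ‖u x‖ₑ ≤ ∫⁻ t in Set.Iic (0 : ℝ), ‖fderiv ℝ u (x + t • v)‖ₑ * ‖v‖ₑ := by
  have hd : ∀ t : ℝ, HasDerivAt (fun t : ℝ => u (x + t • v)) (fderiv ℝ u (x + t • v) v) t := by
    intro t
    have h1 : HasDerivAt (fun t : ℝ => x + t • v) v t := by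
      simpa using ((hasDerivAt_id t).smul_const v).const_add x
    exact ((hu.differentiable one_ne_zero _).hasFDerivAt).comp_hasDerivAt t h1
  have hc : HasCompactSupport (fun t : ℝ => u (x + t • v)) :=
    hs.comp_isClosedEmbedding
      ((Homeomorph.addLeft x).isClosedEmbedding.comp (isClosedEmbedding_smul_left hv))
  have h : ‖u (x + (0 : ℝ) • v)‖ₑ ≤
      ∫⁻ y in Set.Iic (0 : ℝ), ‖deriv (fun t : ℝ => u (x + t • v)) y‖ₑ :=
    hc.enorm_le_lintegral_Ici_deriv (hu.comp (f := fun t : ℝ => x + t • v) (by fun_prop)) 0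
  simp only [zero_smul, add_zero] at h
  refine h.trans (lintegral_mono fun t => ?_)
  rw [(hd t).deriv]
  exact ContinuousLinearMap.le_opENorm _ _

/-- The point $t^{-1}z$ lies in the shell only if $|z|/2<|t|<|z|$: an interval of length $|z|/2$ on
which the Jacobian is at most $8|z|^{-3}$. This is how averaging over rays produces the kernel
$|z|^{-2}$. -/
theorem lintegral_shell_le (z : R3) :
    ∫⁻ t in Set.Iio (0 : ℝ), ENNReal.ofReal |(t ^ 3)⁻¹| *
      ({v : R3 | 1 < ‖v‖ ∧ ‖v‖ < 2}.indicator (fun _ => 1) (t⁻¹ • z)) ≤ 4 * (‖z‖ₑ⁻¹) ^ 2 := by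
  rcases eq_or_ne z 0 with rfl | hz
  · simp
  have hz0 : 0 < ‖z‖ := norm_pos_iff.mpr hz
  have hpt : ∀ t ∈ Set.Iio (0 : ℝ), ENNReal.ofReal |(t ^ 3)⁻¹| *
      ({v : R3 | 1 < ‖v‖ ∧ ‖v‖ < 2}.indicator (fun _ => 1) (t⁻¹ • z)) ≤
      (Set.Ioo (-‖z‖) (-(‖z‖ / 2))).indicator (fun _ => ENNReal.ofReal (8 * (‖z‖⁻¹) ^ 3)) t := by
    intro t ht
    have ht0 : t < 0 := ht
    by_cases hm : t⁻¹ • z ∈ {v : R3 | 1 < ‖v‖ ∧ ‖v‖ < 2}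
    · have hm' := hm
      simp only [Set.mem_ofPred_eq, norm_smul, norm_inv, Real.norm_eq_abs, abs_of_neg ht0] at hm'
      obtain ⟨h1, h2⟩ := hm'
      have hp : 0 < -t := by linarith
      have h1' : -t < ‖z‖ := by rwa [inv_mul_eq_div, one_lt_div hp] at h1
      have h2' : ‖z‖ / 2 < -t := by
        rw [inv_mul_eq_div, div_lt_iff₀ hp] at h2
        linarith
      rw [Set.indicator_of_mem hm, mul_one, Set.indicator_of_mem
        (show t ∈ Set.Ioo _ _ from ⟨by linarith, by linarith⟩)]
      apply ENNReal.ofReal_le_ofReal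
      rw [abs_inv, abs_pow, abs_of_neg ht0, ← inv_pow]
      calc ((-t)⁻¹) ^ 3 ≤ ((‖z‖ / 2)⁻¹) ^ 3 := by gcongr
        _ = _ := by rw [inv_div, div_eq_mul_inv]; ring
    · rw [Set.indicator_of_notMem hm, mul_zero]
      exact zero_le
  refine (setLIntegral_mono' measurableSet_Iio hpt).trans ?_
  refine (setLIntegral_le_lintegral _ _).trans ?_
  rw [lintegral_indicator_const measurableSet_Ioo, Real.volume_Ioo,
    ← ENNReal.ofReal_mul (by positivity), ← ofReal_norm, ← ENNReal.ofReal_inv_of_pos hz0,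
    ← ENNReal.ofReal_pow (by positivity), show (4 : ℝ≥0∞) = ENNReal.ofReal 4 by simp,
    ← ENNReal.ofReal_mul (by positivity)]
  apply ENNReal.ofReal_le_ofReal
  apply le_of_eq
  field_simp
  ring

/-- The pointwise representation estimate: a `C¹` function of compact support is bounded by the
Riesz potential of its gradient. -/
theorem exists_enorm_le_riesz :
    ∃ C : ℝ≥0∞, C ≠ ⊤ ∧ ∀ u : R3 → ℂ, ContDiff ℝ 1 u → HasCompactSupport u → ∀ x : R3,
      ‖u x‖ₑ ≤ C * ∫⁻ y, (‖x - y‖ₑ⁻¹) ^ 2 * ‖fderiv ℝ u y‖ₑ := by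
  -- The ray bound is averaged over $v$ in this shell. Substituting $z=tv$ for fixed $t$ and then
  -- integrating in $t$ yields the Riesz kernel; the factor 8 is 4 from `lintegral_shell_le` times
  -- $2>|v|$.
  set S : Set R3 := {v : R3 | 1 < ‖v‖ ∧ ‖v‖ < 2} with hS
  have hSo : IsOpen S := (isOpen_lt continuous_const continuous_norm).inter
    (isOpen_lt continuous_norm continuous_const)
  have hSm : MeasurableSet S := hSo.measurableSet
  have hS0 : volume S ≠ 0 := by
    refine (hSo.measure_pos volume ⟨EuclideanSpace.single 0 (3 / 2), ?_⟩).ne'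
    simp only [hS, Set.mem_ofPred_eq, PiLp.norm_single]
    norm_num
  have hST : volume S ≠ ⊤ := by
    refine ((measure_mono ?_).trans_lt (measure_ball_lt_top (μ := volume) (x := (0 : R3))
      (r := 2))).ne
    intro v hv
    simpa using hv.2
  refine ⟨(volume S)⁻¹ * 8, ENNReal.mul_ne_top (by simpa using hS0) (by norm_num), ?_⟩
  intro u hu hs x
  have hF : Continuous fun y => ‖fderiv ℝ u y‖ₑ := (hu.continuous_fderiv one_ne_zero).enorm
  set F := fun y => ‖fderiv ℝ u y‖ₑ with hFd
  have hFm : Measurable F := hF.measurable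
  have step1 : volume S * ‖u x‖ₑ ≤ ∫⁻ v in S, ∫⁻ t in Set.Iio (0 : ℝ), F (x + t • v) * 2 := by
    rw [mul_comm, ← setLIntegral_const]
    refine setLIntegral_mono' hSm fun v hv => ?_
    have hv0 : v ≠ 0 := by
      rintro rfl
      have := hv.1
      norm_num at this
    refine (enorm_le_lintegral_ray hu hs x hv0).trans ?_
    -- The endpoint $t=0$ is dropped, since the substitution divides by $t$.
    rw [← restrict_Iio_eq_restrict_Iic]
    refine lintegral_mono fun t => ?_
    refine mul_le_mul_right ?_ _
    rw [← ofReal_norm]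
    exact (ENNReal.ofReal_le_ofReal hv.2.le).trans_eq (by simp)
  have step2 : ∀ t ∈ Set.Iio (0 : ℝ), ∫⁻ v in S, F (x + t • v) * 2 =
      ∫⁻ z, ENNReal.ofReal |(t ^ 3)⁻¹| * (S.indicator (fun _ => 1) (t⁻¹ • z)) *
        (F (x + z) * 2) := by
    intro t ht
    have ht0 : t ≠ 0 := ne_of_lt ht
    have h := lintegral_smul_scale
      (fun z => S.indicator (fun _ => 1) (t⁻¹ • z) * (F (x + z) * 2)) ht0
    rw [← lintegral_const_mul'] at h
    · rw [← lintegral_indicator hSm]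
      simp_rw [mul_assoc]
      rw [← h]
      refine lintegral_congr fun v => ?_
      rw [inv_smul_smul₀ ht0]
      by_cases hv : v ∈ S <;> simp [hv]
    · exact ENNReal.ofReal_ne_top
  have hInd : Measurable (fun p : ℝ × R3 => S.indicator (fun _ => (1 : ℝ≥0∞)) (p.1⁻¹ • p.2)) :=
    (measurable_const.indicator hSm).comp (by fun_prop)
  have hJac : Measurable (fun p : ℝ × R3 => ENNReal.ofReal |(p.1 ^ 3)⁻¹|) := by fun_prop
  have step3 : volume S * ‖u x‖ₑ ≤ 8 * ∫⁻ y, (‖x - y‖ₑ⁻¹) ^ 2 * F y := by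
    refine step1.trans ?_
    rw [lintegral_lintegral_swap
      ((hFm.comp (show Measurable fun p : R3 × ℝ => x + p.2 • p.1 by fun_prop)).mul_const
        2).aemeasurable,
      setLIntegral_congr_fun measurableSet_Iio step2, lintegral_lintegral_swap
      ((hJac.mul hInd).mul ((hFm.comp (measurable_snd.const_add x)).mul_const 2)).aemeasurable]
    have e : ∫⁻ y, (‖x - y‖ₑ⁻¹) ^ 2 * F y = ∫⁻ z, (‖z‖ₑ⁻¹) ^ 2 * F (x + z) := by
      rw [← lintegral_add_left_eq_self _ x]
      refine lintegral_congr fun z => ?_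
      rw [sub_add_cancel_left, enorm_neg]
    rw [e, ← lintegral_const_mul _ (by fun_prop)]
    refine lintegral_mono fun z => ?_
    rw [lintegral_mul_const]
    · calc _ ≤ 4 * (‖z‖ₑ⁻¹) ^ 2 * (F (x + z) * 2) :=
            mul_le_mul_left (lintegral_shell_le z) _
        _ = _ := by ring
    · have h1 : Measurable fun t : ℝ => ENNReal.ofReal |(t ^ 3)⁻¹| := by fun_prop
      have h2 : Measurable fun t : ℝ => t⁻¹ • z := by fun_prop
      exact h1.mul ((measurable_const.indicator hSm).comp h2)
  calc ‖u x‖ₑ = (volume S)⁻¹ * (volume S * ‖u x‖ₑ) := by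
        rw [← mul_assoc, ENNReal.inv_mul_cancel hS0 hST, one_mul]
    _ ≤ (volume S)⁻¹ * (8 * ∫⁻ y, (‖x - y‖ₑ⁻¹) ^ 2 * F y) := by gcongr
    _ = _ := by rw [mul_assoc]

/-! ### Kato's inequality by duality -/

/-- Schur test for the Newton kernel: with weight `w` of Kato norm at most `K`. -/
theorem lintegral_newton_quadratic_le {w g : R3 → ℝ≥0∞} {K : ℝ≥0∞} (hw : Measurable w)
    (hg : Measurable g) (hK : ∀ x, ∫⁻ y, w y * ‖x - y‖ₑ⁻¹ ≤ K) :
    ∫⁻ x, ∫⁻ y, (w x * g x) * (w y * g y) * ‖x - y‖ₑ⁻¹ ≤ 2 * K * ∫⁻ x, w x * g x ^ 2 := by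
  -- This places the square on one variable at a time; integrating the other variable then costs at
  -- most $K$.
  have amgm : ∀ a b : ℝ≥0∞, a * b ≤ a ^ 2 + b ^ 2 := by
    intro a b
    rcases le_total a b with h | h
    · calc a * b ≤ b * b := by gcongr
        _ ≤ _ := by rw [← sq]; exact le_add_self
    · calc a * b ≤ a * a := by gcongr
        _ ≤ _ := by rw [← sq]; exact le_self_add
  have h1 : ∫⁻ x, ∫⁻ y, (w x * g x ^ 2) * (w y * ‖x - y‖ₑ⁻¹) ≤ K * ∫⁻ x, w x * g x ^ 2 := by
    rw [← lintegral_const_mul _ (by fun_prop)]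
    refine lintegral_mono fun x => ?_
    rw [lintegral_const_mul _ (by fun_prop), mul_comm]
    exact mul_le_mul_left (hK x) _
  have h2 : ∫⁻ x, ∫⁻ y, (w y * g y ^ 2) * (w x * ‖y - x‖ₑ⁻¹) =
      ∫⁻ x, ∫⁻ y, (w x * g x ^ 2) * (w y * ‖x - y‖ₑ⁻¹) := by
    rw [lintegral_lintegral_swap]
    apply Measurable.aemeasurable
    unfold Function.uncurry
    fun_prop
  have hpt : ∀ x y, (w x * g x) * (w y * g y) * ‖x - y‖ₑ⁻¹ ≤
      (w x * g x ^ 2) * (w y * ‖x - y‖ₑ⁻¹) + (w y * g y ^ 2) * (w x * ‖y - x‖ₑ⁻¹) := by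
    intro x y
    rw [enorm_sub_rev y x]
    calc _ = w x * w y * ‖x - y‖ₑ⁻¹ * (g x * g y) := by ring
      _ ≤ w x * w y * ‖x - y‖ₑ⁻¹ * (g x ^ 2 + g y ^ 2) := by gcongr; exact amgm _ _
      _ = _ := by ring
  calc _ ≤ ∫⁻ x, ∫⁻ y, ((w x * g x ^ 2) * (w y * ‖x - y‖ₑ⁻¹) +
          (w y * g y ^ 2) * (w x * ‖y - x‖ₑ⁻¹)) :=
        lintegral_mono fun x => lintegral_mono fun y => hpt x y
    _ = ∫⁻ x, ((∫⁻ y, (w x * g x ^ 2) * (w y * ‖x - y‖ₑ⁻¹)) +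
          ∫⁻ y, (w y * g y ^ 2) * (w x * ‖y - x‖ₑ⁻¹)) := by
        refine lintegral_congr fun x => ?_
        rw [lintegral_add_left (by fun_prop)]
    _ = (∫⁻ x, ∫⁻ y, (w x * g x ^ 2) * (w y * ‖x - y‖ₑ⁻¹)) +
          ∫⁻ x, ∫⁻ y, (w y * g y ^ 2) * (w x * ‖y - x‖ₑ⁻¹) := by
        rw [lintegral_add_left]
        apply Measurable.lintegral_prod_right
        fun_prop
    _ ≤ K * (∫⁻ x, w x * g x ^ 2) + K * ∫⁻ x, w x * g x ^ 2 := by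
        rw [h2]; gcongr
    _ = _ := by ring

/-- The dual estimate: the Riesz potential of `w g` in `L²`. -/
theorem lintegral_sq_riesz_le {w g : R3 → ℝ≥0∞} {K C : ℝ≥0∞} (hw : Measurable w)
    (hg : Measurable g) (hK : ∀ x, ∫⁻ y, w y * ‖x - y‖ₑ⁻¹ ≤ K)
    (hC : ∀ x y : R3, ∫⁻ z, (‖x - z‖ₑ⁻¹) ^ 2 * (‖y - z‖ₑ⁻¹) ^ 2 ≤ C * ‖x - y‖ₑ⁻¹) (hCt : C ≠ ⊤) :
    ∫⁻ z, (∫⁻ x, w x * g x * (‖x - z‖ₑ⁻¹) ^ 2) ^ 2 ≤ C * (2 * K * ∫⁻ x, w x * g x ^ 2) := by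
  -- The square is expanded into a double integral, so that integrating in $z$ first composes the
  -- two Riesz kernels.
  have e : ∀ z, (∫⁻ x, w x * g x * (‖x - z‖ₑ⁻¹) ^ 2) ^ 2 =
      ∫⁻ x, ∫⁻ y, (w x * g x) * (w y * g y) * ((‖x - z‖ₑ⁻¹) ^ 2 * (‖y - z‖ₑ⁻¹) ^ 2) := by
    intro z
    rw [sq, ← lintegral_mul_const _ (by fun_prop)]
    refine lintegral_congr fun x => ?_
    rw [← lintegral_const_mul _ (by fun_prop)]
    refine lintegral_congr fun y => ?_
    ring
  simp_rw [e]
  rw [lintegral_lintegral_swap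
    (by
      apply Measurable.aemeasurable
      unfold Function.uncurry
      apply Measurable.lintegral_prod_right
      fun_prop)]
  calc _ ≤ ∫⁻ x, ∫⁻ y, C * ((w x * g x) * (w y * g y) * ‖x - y‖ₑ⁻¹) := by
        refine lintegral_mono fun x => ?_
        rw [lintegral_lintegral_swap
          (by apply Measurable.aemeasurable; unfold Function.uncurry; fun_prop)]
        refine lintegral_mono fun y => ?_
        rw [lintegral_const_mul _ (by fun_prop)]
        calc _ ≤ (w x * g x) * (w y * g y) * (C * ‖x - y‖ₑ⁻¹) := by gcongr; exact hC x y
          _ = _ := by ring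
    _ = C * ∫⁻ x, ∫⁻ y, (w x * g x) * (w y * g y) * ‖x - y‖ₑ⁻¹ := by
        simp_rw [lintegral_const_mul' C _ hCt]
    _ ≤ _ := by gcongr; exact lintegral_newton_quadratic_le hw hg hK

/-- Boundedness of the Riesz potential from `L²` to `L²(w)` for a Kato weight `w`. -/
theorem lintegral_weight_riesz_le {w f : R3 → ℝ≥0∞} {K C : ℝ≥0∞} (hw : Measurable w)
    (hf : Measurable f) (hK : ∀ x, ∫⁻ y, w y * ‖x - y‖ₑ⁻¹ ≤ K) (hKt : K ≠ ⊤)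
    (hC : ∀ x y : R3, ∫⁻ z, (‖x - z‖ₑ⁻¹) ^ 2 * (‖y - z‖ₑ⁻¹) ^ 2 ≤ C * ‖x - y‖ₑ⁻¹) (hCt : C ≠ ⊤) :
    ∫⁻ x, w x * (∫⁻ y, (‖x - y‖ₑ⁻¹) ^ 2 * f y) ^ 2 ≤ 2 * C * K * ∫⁻ y, f y ^ 2 := by
  set P : R3 → ℝ≥0∞ := fun x => ∫⁻ y, (‖x - y‖ₑ⁻¹) ^ 2 * f y with hP
  have hPm : Measurable P := by
    apply Measurable.lintegral_prod_right
    fun_prop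
  -- The potential is truncated in height and in space to make $\int w g_n^2$ finite; otherwise it
  -- could not be cancelled in $A^2\le cA$.
  set g : ℕ → R3 → ℝ≥0∞ := fun n => (Metric.closedBall (0 : R3) n).indicator
    (fun x => min (P x) n) with hg
  have hgm : ∀ n, Measurable (g n) := fun n =>
    (hPm.min measurable_const).indicator Metric.isClosed_closedBall.measurableSet
  have hgP : ∀ n x, g n x ≤ P x := fun n x => by
    refine (Set.indicator_le_self _ _ _).trans (min_le_left _ _)
  have hfin : ∀ n, ∫⁻ x, w x * g n x ^ 2 ≠ ⊤ := by
    intro n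
    -- On the ball of radius $n$ one has $1\le n/|x|$, so the Kato bound at the origin controls the
    -- mass of $w$ there; $n^2$ comes from the height.
    have hb : ∀ x, w x * g n x ^ 2 ≤ (n : ℝ≥0∞) ^ 3 * (w x * ‖0 - x‖ₑ⁻¹) := by
      intro x
      by_cases hx : x ∈ Metric.closedBall (0 : R3) n
      · have h1 : g n x ≤ n := by
          simp only [hg, Set.indicator_of_mem hx]
          exact min_le_right _ _
        have h2 : ‖0 - x‖ₑ ≤ n := by
          rw [zero_sub, enorm_neg, ← ofReal_norm, ← ENNReal.ofReal_natCast]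
          exact ENNReal.ofReal_le_ofReal (by simpa using hx)
        rcases eq_or_ne n 0 with rfl | hn
        · have : g 0 x = 0 := by simpa using h1
          simp [this]
        have h3 : (1 : ℝ≥0∞) ≤ n * ‖0 - x‖ₑ⁻¹ := by
          calc (1 : ℝ≥0∞) = n * (n : ℝ≥0∞)⁻¹ :=
                (ENNReal.mul_inv_cancel (by simpa using hn) (by simp)).symm
            _ ≤ _ := by gcongr
        calc w x * g n x ^ 2 ≤ w x * (n : ℝ≥0∞) ^ 2 * 1 := by rw [mul_one]; gcongr
          _ ≤ w x * (n : ℝ≥0∞) ^ 2 * (n * ‖0 - x‖ₑ⁻¹) := by gcongr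
          _ = _ := by ring
      · simp [hg, hx]
    refine ne_top_of_le_ne_top ?_ (lintegral_mono hb)
    rw [lintegral_const_mul' _ _ (by simp)]
    exact ENNReal.mul_ne_top (by simp) (ne_top_of_le_ne_top hKt (hK 0))
  have hbound : ∀ n, ∫⁻ x, w x * g n x ^ 2 ≤ 2 * C * K * ∫⁻ y, f y ^ 2 := by
    intro n
    set A := ∫⁻ x, w x * g n x ^ 2 with hA
    set J : R3 → ℝ≥0∞ := fun y => ∫⁻ x, w x * g n x * (‖x - y‖ₑ⁻¹) ^ 2 with hJ
    have hgmn := hgm n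
    have hJm : Measurable J := by
      apply Measurable.lintegral_prod_left (f := fun x y => w x * g n x * (‖x - y‖ₑ⁻¹) ^ 2)
      unfold Function.uncurry
      fun_prop
    have h1 : A ≤ ∫⁻ y, f y * J y := by
      calc A ≤ ∫⁻ x, w x * g n x * P x := by
            refine lintegral_mono fun x => ?_
            change w x * g n x ^ 2 ≤ w x * g n x * P x
            rw [sq, ← mul_assoc]
            gcongr
            exact hgP n x
        _ = ∫⁻ x, ∫⁻ y, f y * (w x * g n x * (‖x - y‖ₑ⁻¹) ^ 2) := by
            refine lintegral_congr fun x => ?_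
            rw [hP, ← lintegral_const_mul _ (by fun_prop)]
            refine lintegral_congr fun y => ?_
            ring
        _ = ∫⁻ y, ∫⁻ x, f y * (w x * g n x * (‖x - y‖ₑ⁻¹) ^ 2) := by
            rw [lintegral_lintegral_swap]
            apply Measurable.aemeasurable
            unfold Function.uncurry
            fun_prop
        _ = _ := by
            refine lintegral_congr fun y => ?_
            rw [lintegral_const_mul _ (by fun_prop)]
    -- $J$ is the adjoint potential of $w g_n$. Its $L^2$ norm squared is at most a multiple of $A$,
    -- hence the self-improving inequality.
    have h2 : A * A ≤ (2 * C * K * ∫⁻ y, f y ^ 2) * A := by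
      calc A * A = A ^ 2 := (sq A).symm
        _ ≤ (∫⁻ y, f y * J y) ^ 2 := by gcongr
        _ ≤ (∫⁻ y, f y ^ 2) * ∫⁻ y, J y ^ 2 :=
            sq_lintegral_mul_le hf.aemeasurable hJm.aemeasurable
        _ ≤ (∫⁻ y, f y ^ 2) * (C * (2 * K * A)) := by
            gcongr
            exact lintegral_sq_riesz_le hw (hgm n) hK hC hCt
        _ = _ := by ring
    rcases eq_or_ne A 0 with h0 | h0
    · rw [h0]; exact zero_le
    · exact (ENNReal.mul_le_mul_iff_left h0 (hfin n)).mp h2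
  have hmono : Monotone g := by
    intro m n hmn x
    have hmn' : (m : ℝ) ≤ n := by exact_mod_cast hmn
    refine Set.indicator_le_indicator_of_subset (Metric.closedBall_subset_closedBall hmn')
      (fun _ => zero_le) x |>.trans (Set.indicator_le_indicator ?_)
    have : (m : ℝ≥0∞) ≤ n := by exact_mod_cast hmn
    gcongr
  have hlim : ∀ x, Filter.Tendsto (fun n => g n x) Filter.atTop (nhds (P x)) := by
    intro x
    have h1 : Filter.Tendsto (fun n : ℕ => min (P x) (n : ℝ≥0∞)) Filter.atTop (nhds (P x)) := by
      have := (tendsto_const_nhds (x := P x)).min ENNReal.tendsto_nat_nhds_top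
      simpa using this
    refine h1.congr' ?_
    obtain ⟨N, hN⟩ := exists_nat_ge ‖x‖
    filter_upwards [Filter.eventually_ge_atTop N] with n hn
    have hn' : (N : ℝ) ≤ n := by exact_mod_cast hn
    have hx : x ∈ Metric.closedBall (0 : R3) n := by
      simpa using hN.trans hn'
    simp only [hg, Set.indicator_of_mem hx]
  have hlim2 : ∀ x, Filter.Tendsto (fun n => w x * g n x ^ 2) Filter.atTop
      (nhds (w x * P x ^ 2)) := by
    intro x
    have hm : Monotone fun n => w x * g n x ^ 2 := fun m n hmn => by
      have := hmono hmn x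
      change w x * g m x ^ 2 ≤ w x * g n x ^ 2
      gcongr
    have h2 := tendsto_atTop_iSup hm
    have h3 : ⨆ n, g n x = P x :=
      tendsto_nhds_unique (tendsto_atTop_iSup fun m n hmn => hmono hmn x) (hlim x)
    have h4 : Filter.Tendsto (fun n => g n x ^ 2) Filter.atTop (nhds (P x ^ 2)) :=
      ((ENNReal.continuous_pow 2).tendsto _).comp (hlim x)
    have h5 : ⨆ n, g n x ^ 2 = P x ^ 2 :=
      tendsto_nhds_unique
        (tendsto_atTop_iSup fun m n hmn => pow_le_pow_left' (hmono hmn x) 2) h4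
    rwa [← ENNReal.mul_iSup, h5] at h2
  have hfat : ∫⁻ x, w x * P x ^ 2 ≤ _ :=
    (lintegral_congr fun x => (hlim2 x).liminf_eq.symm).le.trans
      (lintegral_liminf_le fun n => hw.mul ((hgm n).pow_const 2))
  refine hfat.trans ?_
  refine (Filter.liminf_le_liminf (Filter.Eventually.of_forall hbound)).trans ?_
  simp

/-- **Kato's inequality** for a weight of finite global Kato norm. -/
theorem exists_kato_inequality :
    ∃ C : ℝ≥0∞, C ≠ ⊤ ∧ ∀ (w : R3 → ℝ≥0∞) (K : ℝ≥0∞), AEMeasurable w →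
      (∀ x, ∫⁻ y, w y * ‖x - y‖ₑ⁻¹ ≤ K) → K ≠ ⊤ →
      ∀ u : R3 → ℂ, ContDiff ℝ 1 u → HasCompactSupport u →
        ∫⁻ x, w x * ‖u x‖ₑ ^ 2 ≤ C * K * ∫⁻ x, ‖fderiv ℝ u x‖ₑ ^ 2 := by
  obtain ⟨C₁, -, hC₁t, hC₁⟩ := exists_riesz_comp_le
  obtain ⟨C₂, hC₂t, hC₂⟩ := exists_enorm_le_riesz
  refine ⟨C₂ ^ 2 * (2 * C₁), ENNReal.mul_ne_top (ENNReal.pow_ne_top hC₂t)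
    (ENNReal.mul_ne_top (by norm_num) hC₁t), ?_⟩
  intro w K hw hK hKt u hu hs
  have hF : Measurable fun y => ‖fderiv ℝ u y‖ₑ :=
    (hu.continuous_fderiv one_ne_zero).enorm.measurable
  have hK' : ∀ x, ∫⁻ y, hw.mk w y * ‖x - y‖ₑ⁻¹ ≤ K := by
    intro x
    refine (lintegral_congr_ae ?_).trans_le (hK x)
    filter_upwards [hw.ae_eq_mk] with y hy
    rw [hy]
  have h := lintegral_weight_riesz_le hw.measurable_mk hF hK' hKt hC₁ hC₁t
  calc ∫⁻ x, w x * ‖u x‖ₑ ^ 2 = ∫⁻ x, hw.mk w x * ‖u x‖ₑ ^ 2 := by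
        refine lintegral_congr_ae ?_
        filter_upwards [hw.ae_eq_mk] with y hy
        rw [hy]
    _ ≤ ∫⁻ x, C₂ ^ 2 * (hw.mk w x * (∫⁻ y, (‖x - y‖ₑ⁻¹) ^ 2 * ‖fderiv ℝ u y‖ₑ) ^ 2) := by
        refine lintegral_mono fun x => ?_
        calc _ ≤ hw.mk w x * (C₂ * ∫⁻ y, (‖x - y‖ₑ⁻¹) ^ 2 * ‖fderiv ℝ u y‖ₑ) ^ 2 := by
              gcongr; exact hC₂ u hu hs x
          _ = _ := by ring
    _ ≤ C₂ ^ 2 * (2 * C₁ * K * ∫⁻ x, ‖fderiv ℝ u x‖ₑ ^ 2) := by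
        rw [lintegral_const_mul' _ _ (ENNReal.pow_ne_top hC₂t)]
        gcongr
    _ = _ := by ring

/-! ### Poincaré's inequality on convex sets -/

theorem lintegral_rotate {α β γ : Type*} [MeasurableSpace α] [MeasurableSpace β]
    [MeasurableSpace γ] {μ : Measure α} {ν : Measure β} {ρ : Measure γ} [SFinite μ] [SFinite ν]
    [SFinite ρ] {f : (α × β) × γ → ℝ≥0∞} (hf : Measurable f) :
    ∫⁻ x, ∫⁻ y, ∫⁻ t, f ((x, y), t) ∂ρ ∂ν ∂μ = ∫⁻ t, ∫⁻ x, ∫⁻ y, f ((x, y), t) ∂ν ∂μ ∂ρ := by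
  have h1 : ∀ x, ∫⁻ y, ∫⁻ t, f ((x, y), t) ∂ρ ∂ν = ∫⁻ t, ∫⁻ y, f ((x, y), t) ∂ν ∂ρ := fun x =>
    lintegral_lintegral_swap (f := fun y t => f ((x, y), t))
      (hf.comp (by fun_prop : Measurable fun p : β × γ => ((x, p.1), p.2))).aemeasurable
  simp_rw [h1]
  refine lintegral_lintegral_swap (f := fun x t => ∫⁻ y, f ((x, y), t) ∂ν) ?_
  exact (Measurable.lintegral_prod_right (f := fun q : α × γ => fun y => f ((q.1, y), q.2))
    (hf.comp (by fun_prop : Measurable fun p : (α × γ) × β => ((p.1.1, p.2), p.1.2)))).aemeasurable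

theorem lintegral_const_mul_triple {α β γ : Type*} [MeasurableSpace α] [MeasurableSpace β]
    [MeasurableSpace γ] {μ : Measure α} {ν : Measure β} {ρ : Measure γ} [SFinite ν]
    [SFinite ρ] {f : (α × β) × γ → ℝ≥0∞} (hf : Measurable f) (c : ℝ≥0∞) :
    ∫⁻ x, ∫⁻ y, c * ∫⁻ t, f ((x, y), t) ∂ρ ∂ν ∂μ =
      c * ∫⁻ x, ∫⁻ y, ∫⁻ t, f ((x, y), t) ∂ρ ∂ν ∂μ := by
  have hm : Measurable fun p : α × β => ∫⁻ t, f (p, t) ∂ρ := hf.lintegral_prod_right'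
  rw [← lintegral_const_mul _ hm.lintegral_prod_right']
  refine lintegral_congr fun x => ?_
  rw [lintegral_const_mul]
  exact hm.comp measurable_prodMk_left

/-- The fundamental theorem of calculus on the segment from $x$ to $y$, followed by Cauchy-Schwarz
in $t$. -/
theorem sq_enorm_sub_le_lintegral {u : R3 → ℂ} (hu : ContDiff ℝ 1 u) (x y : R3) :
    ‖u x - u y‖ₑ ^ 2 ≤ ‖x - y‖ₑ ^ 2 *
      ∫⁻ t in Set.Icc (0 : ℝ) 1, ‖fderiv ℝ u ((1 - t) • x + t • y)‖ₑ ^ 2 := by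
  have hF : Measurable fun y => ‖fderiv ℝ u y‖ₑ :=
    (hu.continuous_fderiv one_ne_zero).enorm.measurable
  have hd : ∀ t : ℝ, HasDerivAt (fun t : ℝ => u ((1 - t) • x + t • y))
      (fderiv ℝ u ((1 - t) • x + t • y) (y - x)) t := by
    intro t
    have h1 : HasDerivAt (fun t : ℝ => (1 - t) • x + t • y) (y - x) t := by
      have := (((hasDerivAt_id t).const_sub 1).smul_const x).add
        ((hasDerivAt_id t).smul_const y)
      refine this.congr_deriv ?_
      simp only [neg_smul, one_smul]
      abel
    exact ((hu.differentiable one_ne_zero _).hasFDerivAt).comp_hasDerivAt t h1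
  have hc : ContDiff ℝ 1 (fun t : ℝ => u ((1 - t) • x + t • y)) :=
    hu.comp (f := fun t : ℝ => (1 - t) • x + t • y) (by fun_prop)
  have h := enorm_sub_le_lintegral_deriv_of_contDiffOn_Icc (hc.contDiffOn (s := Set.Icc 0 1))
    zero_le_one
  simp only [sub_self, zero_smul, one_smul, zero_add, sub_zero, add_zero] at h
  have hg : Measurable fun t : ℝ => ‖fderiv ℝ u ((1 - t) • x + t • y)‖ₑ :=
    hF.comp (g := fun y => ‖fderiv ℝ u y‖ₑ) (f := fun t : ℝ => (1 - t) • x + t • y) (by fun_prop)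
  have h2 : ‖u x - u y‖ₑ ≤ ‖x - y‖ₑ *
      ∫⁻ t in Set.Icc (0 : ℝ) 1, ‖fderiv ℝ u ((1 - t) • x + t • y)‖ₑ := by
    rw [enorm_sub_rev]
    refine h.trans ?_
    rw [← lintegral_const_mul _ hg]
    refine lintegral_mono fun t => ?_
    rw [(hd t).deriv, mul_comm, enorm_sub_rev x y]
    exact ContinuousLinearMap.le_opENorm _ _
  have h3 := sq_lintegral_mul_le (μ := volume.restrict (Set.Icc (0 : ℝ) 1)) hg.aemeasurable
    (aemeasurable_const (b := (1 : ℝ≥0∞)))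
  simp only [mul_one, one_pow, lintegral_const, Measure.restrict_apply MeasurableSet.univ,
    Set.univ_inter, Real.volume_Icc, sub_zero, ENNReal.ofReal_one] at h3
  calc _ ≤ (‖x - y‖ₑ * ∫⁻ t in Set.Icc (0 : ℝ) 1, ‖fderiv ℝ u ((1 - t) • x + t • y)‖ₑ) ^ 2 := by
        gcongr
    _ ≤ _ := by rw [mul_pow]; gcongr

/-- By convexity $y\mapsto(1-t)x+ty$ maps $Q$ into itself, and its Jacobian $t^3$ is at least $1/8$.
-/
theorem lintegral_convex_comb_le {Q : Set R3} (hQ : Convex ℝ Q) (hQm : MeasurableSet Q)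
    (F : R3 → ℝ≥0∞) {x : R3} (hx : x ∈ Q) {t : ℝ} (ht : 1 / 2 ≤ t) (ht1 : t ≤ 1) :
    ∫⁻ y in Q, F ((1 - t) • x + t • y) ≤ 8 * ∫⁻ y in Q, F y := by
  have ht0 : 0 < t := by linarith
  have h := lintegral_smul_scale (fun z => Q.indicator F ((1 - t) • x + z)) ht0.ne'
  rw [lintegral_add_left_eq_self] at h
  calc _ ≤ ∫⁻ y, Q.indicator F ((1 - t) • x + t • y) := by
        rw [← lintegral_indicator hQm]
        refine lintegral_mono fun y => ?_
        by_cases hy : y ∈ Q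
        · rw [Set.indicator_of_mem hy, Set.indicator_of_mem
            (hQ hx hy (by linarith) ht0.le (by ring))]
        · rw [Set.indicator_of_notMem hy]; exact zero_le
    _ = ENNReal.ofReal |(t ^ 3)⁻¹| * ∫⁻ y in Q, F y := by
        rw [h, lintegral_indicator hQm]
    _ ≤ _ := by
        gcongr
        rw [abs_of_pos (by positivity), show (8 : ℝ≥0∞) = ENNReal.ofReal 8 by simp]
        apply ENNReal.ofReal_le_ofReal
        rw [inv_le_comm₀ (by positivity) (by norm_num)]
        calc (8 : ℝ)⁻¹ = (1 / 2) ^ 3 := by norm_num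
          _ ≤ _ := by gcongr

/-- Poincaré's inequality on a convex set, for differences. -/
theorem lintegral_sq_sub_le {Q : Set R3} (hQ : Convex ℝ Q) (hQm : MeasurableSet Q) {d : ℝ≥0∞}
    (hd : ∀ x ∈ Q, ∀ y ∈ Q, ‖x - y‖ₑ ≤ d) {u : R3 → ℂ} (hu : ContDiff ℝ 1 u) :
    ∫⁻ x in Q, ∫⁻ y in Q, ‖u x - u y‖ₑ ^ 2 ≤
      8 * d ^ 2 * volume Q * ∫⁻ x in Q, ‖fderiv ℝ u x‖ₑ ^ 2 := by
  have hFm : Measurable fun y => ‖fderiv ℝ u y‖ₑ ^ 2 :=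
    (hu.continuous_fderiv one_ne_zero).enorm.measurable.pow_const 2
  set F := fun y => ‖fderiv ℝ u y‖ₑ ^ 2 with hF
  set I := ∫⁻ x in Q, F x with hI
  have hm3 : Measurable fun p : (R3 × R3) × ℝ => F ((1 - p.2) • p.1.1 + p.2 • p.1.2) :=
    hFm.comp (by fun_prop)
  have hm2 : ∀ t : ℝ, Measurable fun p : R3 × R3 => F ((1 - t) • p.1 + t • p.2) :=
    fun t => hFm.comp (by fun_prop)
  have hmid : ∀ t ∈ Set.Icc (0 : ℝ) 1,
      ∫⁻ x in Q, ∫⁻ y in Q, F ((1 - t) • x + t • y) ≤ 8 * I * volume Q := by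
    intro t ht
    -- One of $t$ and $1-t$ is at least $1/2$; the change of variables is made in $y$ or in $x$
    -- accordingly.
    rcases le_total (1 / 2) t with h | h
    · calc _ ≤ ∫⁻ _ in Q, 8 * I :=
            setLIntegral_mono' hQm fun x hx => lintegral_convex_comb_le hQ hQm F hx h ht.2
        _ = _ := by rw [setLIntegral_const]
    · rw [lintegral_lintegral_swap (hm2 t).aemeasurable]
      calc _ ≤ ∫⁻ _ in Q, 8 * I := by
            refine setLIntegral_mono' hQm fun y hy => ?_
            have := lintegral_convex_comb_le hQ hQm F hy (t := 1 - t) (by linarith)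
              (by linarith [ht.1])
            simpa only [sub_sub_cancel, add_comm] using this
        _ = _ := by rw [setLIntegral_const]
  calc _ ≤ ∫⁻ x in Q, ∫⁻ y in Q, d ^ 2 *
          ∫⁻ t in Set.Icc (0 : ℝ) 1, F ((1 - t) • x + t • y) := by
        refine setLIntegral_mono' hQm fun x hx => setLIntegral_mono' hQm fun y hy => ?_
        refine (sq_enorm_sub_le_lintegral hu x y).trans ?_
        gcongr
        exact hd x hx y hy
    _ = d ^ 2 * ∫⁻ t in Set.Icc (0 : ℝ) 1, ∫⁻ x in Q, ∫⁻ y in Q, F ((1 - t) • x + t • y) := by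
        rw [lintegral_const_mul_triple hm3, lintegral_rotate hm3]
    _ ≤ d ^ 2 * ∫⁻ _ in Set.Icc (0 : ℝ) 1, 8 * I * volume Q := by
        gcongr 1
        exact setLIntegral_mono' measurableSet_Icc hmid
    _ = _ := by
        rw [setLIntegral_const, Real.volume_Icc]
        simp only [sub_zero, ENNReal.ofReal_one]
        ring

/-! ### Smooth approximation in $H^1$ -/

/-- Young's inequality `‖φ ⋆ u‖₂ ≤ ‖u‖₂` for a probability density `φ`. -/
theorem lintegral_sq_convolution_le {φ : R3 → ℝ} (hφ : Measurable φ)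
    (h1 : ∫⁻ t, ‖φ t‖ₑ = 1) {u : R3 → ℂ} (hu : StronglyMeasurable u) :
    ∫⁻ x, ‖∫ t, φ t • u (x - t)‖ₑ ^ 2 ≤ ∫⁻ x, ‖u x‖ₑ ^ 2 := by
  have hum : Measurable fun x => ‖u x‖ₑ := hu.enorm
  -- Jensen's inequality, obtained as Cauchy-Schwarz for the measure $|\varphi|\,dt$ of mass one.
  have hp : ∀ x, ‖∫ t, φ t • u (x - t)‖ₑ ^ 2 ≤ ∫⁻ t, ‖φ t‖ₑ * ‖u (x - t)‖ₑ ^ 2 := by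
    intro x
    have hx : Measurable fun t => ‖u (x - t)‖ₑ := hum.comp (by fun_prop)
    have hcs := sq_lintegral_mul_le (μ := volume.withDensity fun t => ‖φ t‖ₑ) hx.aemeasurable
      (aemeasurable_const (b := (1 : ℝ≥0∞)))
    rw [lintegral_withDensity_eq_lintegral_mul _ (by fun_prop) (by fun_prop),
      lintegral_withDensity_eq_lintegral_mul _ (by fun_prop) (by fun_prop),
      lintegral_withDensity_eq_lintegral_mul _ (by fun_prop) (by fun_prop)] at hcs
    simp only [Pi.mul_apply, mul_one, one_pow, h1] at hcs
    refine le_trans (pow_le_pow_left' ?_ 2) hcs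
    refine (enorm_integral_le_lintegral_enorm _).trans_eq ?_
    simp_rw [enorm_smul]
  calc _ ≤ ∫⁻ x, ∫⁻ t, ‖φ t‖ₑ * ‖u (x - t)‖ₑ ^ 2 := lintegral_mono hp
    _ = ∫⁻ t, ∫⁻ x, ‖φ t‖ₑ * ‖u (x - t)‖ₑ ^ 2 := by
      refine lintegral_lintegral_swap (Measurable.aemeasurable ?_)
      have : Measurable fun p : R3 × R3 => ‖u (p.1 - p.2)‖ₑ := hum.comp (by fun_prop)
      unfold Function.uncurry
      fun_prop
    _ = ∫⁻ t, ‖φ t‖ₑ * ∫⁻ x, ‖u x‖ₑ ^ 2 := by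
      refine lintegral_congr fun t => ?_
      have : Measurable fun x => ‖u (x - t)‖ₑ := hum.comp (by fun_prop)
      rw [lintegral_const_mul _ (by fun_prop), lintegral_sub_right_eq_self (fun x => ‖u x‖ₑ ^ 2) t]
    _ = _ := by rw [lintegral_mul_const _ (by fun_prop), h1, one_mul]

/-- The operator norm is at most the Hilbert-Schmidt norm. This connects the norm of `fderiv` with
the coordinates of a weak gradient. -/
theorem enorm_sq_clm_le (L : R3 →L[ℝ] ℂ) :
    ‖L‖ₑ ^ 2 ≤ ∑ i, ‖L (EuclideanSpace.single i 1)‖ₑ ^ 2 := by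
  have h : ‖L‖ ≤ √(∑ i, ‖L (EuclideanSpace.single i 1)‖ ^ 2) := by
    refine ContinuousLinearMap.opNorm_le_bound _ (Real.sqrt_nonneg _) fun x => ?_
    have hx : x = ∑ i, x i • (EuclideanSpace.single i 1 : R3) := by
      ext j
      simp [Pi.single_apply]
    calc ‖L x‖ = ‖∑ i, x i • L (EuclideanSpace.single i 1)‖ := by
          conv_lhs => rw [hx]
          simp [map_sum]
      _ ≤ ∑ i, ‖L (EuclideanSpace.single i 1)‖ * ‖x i‖ := by
          refine (norm_sum_le _ _).trans (Finset.sum_le_sum fun i _ => ?_)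
          rw [norm_smul, mul_comm]
      _ ≤ _ := by
          rw [EuclideanSpace.norm_eq]
          exact Real.sum_mul_le_sqrt_mul_sqrt _ _ _
  have h2 : ‖L‖ ^ 2 ≤ ∑ i, ‖L (EuclideanSpace.single i 1)‖ ^ 2 := by
    rw [← Real.sqrt_le_sqrt_iff (by positivity), Real.sqrt_sq (norm_nonneg _)]
    exact h
  simp_rw [← ofReal_norm, ← ENNReal.ofReal_pow (norm_nonneg _)]
  rw [← ENNReal.ofReal_sum_of_nonneg fun i _ => by positivity]
  exact ENNReal.ofReal_le_ofReal h2

theorem lintegral_sq_enorm_eq (f : R3 → ℂ) : ∫⁻ x, ‖f x‖ₑ ^ 2 = eLpNorm f 2 volume ^ 2 := by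
  have := eLpNorm_nnreal_pow_eq_lintegral (μ := (volume : Measure R3)) (f := f) (p := 2)
    (by norm_num)
  simpa [ENNReal.rpow_two] using this.symm

open scoped Convolution in
/-- Mollification commutes with weak derivatives. -/
theorem fderiv_convolution_of_hasWeakGradient {u : L2} {G : Fin 3 → L2} (h : HasWeakGradient u G)
    {φ : R3 → ℝ} (hφ : ContDiff ℝ ∞ φ) (hs : HasCompactSupport φ) (x : R3) (i : Fin 3) :
    fderiv ℝ (φ ⋆[ContinuousLinearMap.lsmul ℝ ℝ, volume] u : R3 → ℂ) x
      (EuclideanSpace.single i 1) = ∫ t, φ t • G i (x - t) := by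
  have hloc : LocallyIntegrable u volume := (Lp.memLp u).locallyIntegrable (by norm_num)
  have hd := hs.hasFDerivAt_convolution_left (ContinuousLinearMap.lsmul ℝ ℝ : ℝ →L[ℝ] ℂ →L[ℝ] ℂ)
    (μ := volume) (hφ.of_le (by simp)) hloc x
  rw [hd.fderiv]
  have hce := (hs.fderiv ℝ).convolutionExists_left
    ((ContinuousLinearMap.lsmul ℝ ℝ : ℝ →L[ℝ] ℂ →L[ℝ] ℂ).precompL R3)
    (hφ.continuous_fderiv (by simp)) hloc x
  rw [convolution_def, ContinuousLinearMap.integral_apply hce]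
  simp only [ContinuousLinearMap.precompL_apply, ContinuousLinearMap.lsmul_apply]
  -- The weak derivative is tested against $t\mapsto\varphi(x-t)$; the sign from the chain rule
  -- cancels the one in `HasWeakGradient`.
  have hη : ContDiff ℝ ∞ fun t => φ (x - t) := hφ.comp (by fun_prop)
  have hηs : HasCompactSupport fun t => φ (x - t) :=
    hs.comp_homeomorph (Homeomorph.subLeft x)
  have hw := h i _ hη hηs
  have hfd : ∀ t, fderiv ℝ (fun t => φ (x - t)) t (EuclideanSpace.single i 1) =
      - fderiv ℝ φ (x - t) (EuclideanSpace.single i 1) := by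
    intro t
    have h1 : HasFDerivAt (fun t : R3 => x - t) (-(ContinuousLinearMap.id ℝ R3)) t :=
      (hasFDerivAt_id t).const_sub x
    have h2 := ((hφ.differentiable (by simp) (x - t)).hasFDerivAt).comp t h1
    have h3 : fderiv ℝ (fun t => φ (x - t)) t = _ := h2.fderiv
    rw [h3]
    simp
  simp_rw [hfd, neg_smul] at hw
  rw [integral_neg, neg_inj] at hw
  rw [← integral_sub_left_eq_self _ volume x, ← integral_sub_left_eq_self
    (fun t => φ t • G i (x - t)) volume x]
  simpa only [sub_sub_cancel] using hw

theorem eLpNorm_le_of_lintegral_sq_le {f g : R3 → ℂ}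
    (h : ∫⁻ x, ‖f x‖ₑ ^ 2 ≤ ∫⁻ x, ‖g x‖ₑ ^ 2) : eLpNorm f 2 volume ≤ eLpNorm g 2 volume := by
  rw [lintegral_sq_enorm_eq, lintegral_sq_enorm_eq] at h
  exact (ENNReal.pow_le_pow_left_iff two_ne_zero).mp h

/-- The gradient of a product with a slowly varying cutoff. -/
theorem lintegral_sq_fderiv_smul_le {χ : R3 → ℝ} (hχ : ContDiff ℝ 1 χ) (h1 : ∀ x, ‖χ x‖ ≤ 1)
    {ε : ℝ} (hε : ∀ x, ‖fderiv ℝ χ x‖ ≤ ε) {v : R3 → ℂ} (hv : ContDiff ℝ 1 v) :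
    ∫⁻ x, ‖fderiv ℝ (fun y => χ y • v y) x‖ₑ ^ 2 ≤
      ∑ i, (eLpNorm (fun x => fderiv ℝ v x (EuclideanSpace.single i 1)) 2 volume +
        ENNReal.ofReal ε * eLpNorm v 2 volume) ^ 2 := by
  have hε0 : 0 ≤ ε := (norm_nonneg _).trans (hε 0)
  have hfd : ∀ x e, fderiv ℝ (fun y => χ y • v y) x e =
      χ x • fderiv ℝ v x e + fderiv ℝ χ x e • v x := by
    intro x e
    rw [fderiv_fun_smul (hχ.differentiable one_ne_zero x) (hv.differentiable one_ne_zero x)]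
    simp
  have hvc : ∀ e, Continuous fun x => fderiv ℝ v x e := fun e =>
    (hv.continuous_fderiv one_ne_zero).clm_apply continuous_const
  have hχc : ∀ e, Continuous fun x => fderiv ℝ χ x e := fun e =>
    (hχ.continuous_fderiv one_ne_zero).clm_apply continuous_const
  calc _ ≤ ∫⁻ x, ∑ i, ‖χ x • fderiv ℝ v x (EuclideanSpace.single i 1) +
          fderiv ℝ χ x (EuclideanSpace.single i 1) • v x‖ₑ ^ 2 := by
        refine lintegral_mono fun x => (enorm_sq_clm_le _).trans_eq ?_
        simp_rw [hfd]
    _ = ∑ i, ∫⁻ x, ‖χ x • fderiv ℝ v x (EuclideanSpace.single i 1) +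
          fderiv ℝ χ x (EuclideanSpace.single i 1) • v x‖ₑ ^ 2 := by
        refine lintegral_finsetSum _ fun i _ => ?_
        exact (((hχ.continuous.smul (hvc _)).add
          ((hχc _).smul hv.continuous)).enorm.measurable).pow_const 2
    _ ≤ _ := by
        refine Finset.sum_le_sum fun i _ => ?_
        rw [lintegral_sq_enorm_eq]
        refine pow_le_pow_left' ?_ 2
        refine (eLpNorm_add_le (hχ.continuous.smul (hvc _)).aestronglyMeasurable
          ((hχc _).smul hv.continuous).aestronglyMeasurable (by norm_num)).trans ?_
        refine add_le_add (eLpNorm_mono fun x => ?_) ?_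
        · rw [Pi.smul_apply', norm_smul]
          exact mul_le_of_le_one_left (norm_nonneg _) (h1 x)
        · refine eLpNorm_le_mul_eLpNorm_of_ae_le_mul (Filter.Eventually.of_forall fun x => ?_) 2
          rw [Pi.smul_apply', norm_smul]
          refine mul_le_mul_of_nonneg_right ?_ (norm_nonneg _)
          refine ((fderiv ℝ χ x).le_opNorm _).trans ?_
          simpa using hε x

/-- One fixed bump is dilated by $n+1$, so its gradient decays and cutting off costs nothing in the
limit. -/
theorem exists_cutoff : ∃ M : ℝ, ∀ n : ℕ, ∃ χ : R3 → ℝ, ContDiff ℝ 1 χ ∧ HasCompactSupport χ ∧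
    (∀ x, ‖χ x‖ ≤ 1) ∧ (∀ x, ‖fderiv ℝ χ x‖ ≤ M * ((n : ℝ) + 1)⁻¹) ∧
    ∀ x, ‖x‖ ≤ n → χ x = 1 := by
  let b : ContDiffBump (0 : R3) := ⟨1, 2, one_pos, one_lt_two⟩
  have hb : ContDiff ℝ 1 b := b.contDiff
  obtain ⟨M, hM⟩ := (hb.continuous_fderiv one_ne_zero).bounded_above_of_compact_support
    (b.hasCompactSupport.fderiv ℝ)
  refine ⟨M, fun n => ?_⟩
  have hn : (0 : ℝ) < (n : ℝ) + 1 := by positivity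
  refine ⟨fun x => b (((n : ℝ) + 1)⁻¹ • x), hb.comp (by fun_prop),
    b.hasCompactSupport.comp_smul (inv_ne_zero hn.ne'), fun x => ?_, fun x => ?_, fun x hx => ?_⟩
  · rw [Real.norm_of_nonneg b.nonneg]
    exact b.le_one
  · rw [fderiv_comp_smul, norm_smul, mul_comm, norm_inv, Real.norm_of_nonneg hn.le]
    gcongr
    exact hM _
  · apply b.one_of_mem_closedBall
    rw [mem_closedBall_zero_iff, norm_smul, norm_inv, Real.norm_of_nonneg hn.le]
    change _ ≤ (1 : ℝ)
    rw [inv_mul_le_iff₀ hn]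
    linarith

open scoped Convolution in
/-- Functions in `H¹` are almost everywhere limits of `C¹` functions of compact support whose
Dirichlet integrals are asymptotically not larger. -/
theorem exists_smooth_approx {u : L2} {G : Fin 3 → L2} (h : HasWeakGradient u G) :
    ∃ (w : ℕ → R3 → ℂ) (c : ℕ → ℝ≥0∞), (∀ n, ContDiff ℝ 1 (w n)) ∧
      (∀ n, HasCompactSupport (w n)) ∧
      (∀ᵐ x, Filter.Tendsto (fun n => w n x) Filter.atTop (nhds (u x))) ∧
      (∀ n, ∫⁻ x, ‖fderiv ℝ (w n) x‖ₑ ^ 2 ≤ c n) ∧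
      Filter.Tendsto c Filter.atTop (nhds (∑ i, ∫⁻ x, ‖G i x‖ₑ ^ 2)) := by
  obtain ⟨M, hM⟩ := exists_cutoff
  choose χ hχ hχs hχ1 hχd hχe using hM
  -- The ratio of the two radii stays equal to 2, as the almost everywhere convergence of the
  -- mollifications requires.
  let b : ℕ → ContDiffBump (0 : R3) := fun n =>
    ⟨((n : ℝ) + 1)⁻¹, 2 * ((n : ℝ) + 1)⁻¹, by positivity, by
      have : (0 : ℝ) < ((n : ℝ) + 1)⁻¹ := by positivity
      linarith⟩
  have hinv : Filter.Tendsto (fun n : ℕ => ((n : ℝ) + 1)⁻¹) Filter.atTop (nhds 0) := by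
    simpa [one_div] using tendsto_one_div_add_atTop_nhds_zero_nat (𝕜 := ℝ)
  have hloc : LocallyIntegrable u volume := (Lp.memLp u).locallyIntegrable (by norm_num)
  let φ : ℕ → R3 → ℝ := fun n => (b n).normed volume
  have hφ : ∀ n, ContDiff ℝ ∞ (φ n) := fun n => (b n).contDiff_normed
  have hφs : ∀ n, HasCompactSupport (φ n) := fun n => (b n).hasCompactSupport_normed
  have hφ1 : ∀ n, ∫⁻ t, ‖φ n t‖ₑ = 1 := by
    intro n
    have h1 : ∫ t, φ n t = 1 := (b n).integral_normed
    have h2 : ∀ t, ‖φ n t‖ₑ = ENNReal.ofReal (φ n t) := fun t =>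
      Real.enorm_eq_ofReal ((b n).nonneg_normed t)
    simp_rw [h2]
    rw [← ofReal_integral_eq_lintegral_ofReal (b n).integrable_normed
      (Filter.Eventually.of_forall (b n).nonneg_normed), h1, ENNReal.ofReal_one]
  let v : ℕ → R3 → ℂ := fun n => φ n ⋆[ContinuousLinearMap.lsmul ℝ ℝ, volume] u
  have hv : ∀ n, ContDiff ℝ 1 (v n) := fun n =>
    (hφs n).contDiff_convolution_left _ ((hφ n).of_le (by simp)) hloc
  have hvlim : ∀ᵐ x, Filter.Tendsto (fun n => v n x) Filter.atTop (nhds (u x)) := by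
    refine ContDiffBump.ae_convolution_tendsto_right_of_locallyIntegrable (φ := b) (K := 2)
      ?_ ?_ hloc
    · simpa using hinv.const_mul 2
    · exact Filter.Eventually.of_forall fun n => le_rfl
  have hvn : ∀ n, eLpNorm (v n) 2 volume ≤ eLpNorm u 2 volume := fun n =>
    eLpNorm_le_of_lintegral_sq_le (lintegral_sq_convolution_le (hφ n).continuous.measurable
      (hφ1 n) (Lp.stronglyMeasurable u))
  have hdn : ∀ n i, eLpNorm (fun x => fderiv ℝ (v n) x (EuclideanSpace.single i 1)) 2 volume ≤
      eLpNorm (G i) 2 volume := by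
    intro n i
    refine eLpNorm_le_of_lintegral_sq_le ?_
    simp_rw [v, fderiv_convolution_of_hasWeakGradient h (hφ n) (hφs n)]
    exact lintegral_sq_convolution_le (hφ n).continuous.measurable (hφ1 n)
      (Lp.stronglyMeasurable (G i))
  refine ⟨fun n x => χ n x • v n x, fun n => ∑ i, (eLpNorm (G i) 2 volume +
    ENNReal.ofReal (M * ((n : ℝ) + 1)⁻¹) * eLpNorm u 2 volume) ^ 2,
    fun n => (hχ n).smul (hv n), fun n => (hχs n).smul_right, ?_, fun n => ?_, ?_⟩
  · filter_upwards [hvlim] with x hx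
    refine hx.congr' ?_
    obtain ⟨N, hN⟩ := exists_nat_ge ‖x‖
    filter_upwards [Filter.eventually_ge_atTop N] with n hn
    have hn' : (N : ℝ) ≤ n := by exact_mod_cast hn
    rw [hχe n x (hN.trans hn'), one_smul]
  · refine (lintegral_sq_fderiv_smul_le (hχ n) (hχ1 n) (hχd n) (hv n)).trans ?_
    exact Finset.sum_le_sum fun i _ =>
      pow_le_pow_left' (add_le_add (hdn n i) (mul_le_mul_right (hvn n) _)) 2
  · refine tendsto_finsetSum _ fun i _ => ?_
    rw [lintegral_sq_enorm_eq]
    have h1 : Filter.Tendsto (fun n : ℕ => ENNReal.ofReal (M * ((n : ℝ) + 1)⁻¹))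
        Filter.atTop (nhds 0) := by
      rw [← ENNReal.ofReal_zero]
      exact ENNReal.tendsto_ofReal (by simpa using hinv.const_mul M)
    have h2 : Filter.Tendsto (fun n : ℕ => ENNReal.ofReal (M * ((n : ℝ) + 1)⁻¹) *
        eLpNorm u 2 volume) Filter.atTop (nhds 0) := by
      simpa using ENNReal.Tendsto.mul_const h1 (Or.inr (Lp.memLp u).2.ne)
    have h3 := (tendsto_const_nhds (x := eLpNorm (G i) 2 volume)).add h2
    rw [add_zero] at h3
    exact ((ENNReal.continuous_pow 2).tendsto _).comp h3

/-! ### Passage to $H^1$ by Fatou's lemma -/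

/-- Fatou's lemma for the counting measure. -/
theorem sum_liminf_le {ι : Type*} (s : Finset ι) (f : ι → ℕ → ℝ≥0∞) :
    ∑ k ∈ s, Filter.liminf (f k) Filter.atTop ≤
      Filter.liminf (fun n => ∑ k ∈ s, f k n) Filter.atTop := by
  let _ : MeasurableSpace s := ⊤
  have h := lintegral_liminf_le (μ := (Measure.count : Measure s)) (u := Filter.atTop)
    (f := fun n (k : s) => f k n) fun n => measurable_from_top
  simp only [lintegral_count, tsum_fintype] at h
  rwa [Finset.sum_coe_sort s fun k => Filter.liminf (f k) Filter.atTop,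
    funext fun n => Finset.sum_coe_sort s fun k => f k n] at h

/-- Kato's inequality on `H¹`. -/
theorem exists_kato_inequality_sobolev :
    ∃ C : ℝ≥0∞, C ≠ ⊤ ∧ ∀ (w : R3 → ℝ≥0∞) (K : ℝ≥0∞), AEMeasurable w →
      (∀ x, w x ≠ ⊤) → (∀ x, ∫⁻ y, w y * ‖x - y‖ₑ⁻¹ ≤ K) → K ≠ ⊤ →
      ∀ (u : L2) (G : Fin 3 → L2), HasWeakGradient u G →
        ∫⁻ x, w x * ‖u x‖ₑ ^ 2 ≤ C * K * ∑ i, ∫⁻ x, ‖G i x‖ₑ ^ 2 := by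
  obtain ⟨C, hCt, hC⟩ := exists_kato_inequality
  refine ⟨C, hCt, fun w K hw hwt hK hKt u G hG => ?_⟩
  obtain ⟨v, c, hv, hvs, hlim, hvc, hc⟩ := exists_smooth_approx hG
  have h1 : ∀ᵐ x, w x * ‖u x‖ₑ ^ 2 ≤
      Filter.liminf (fun n => w x * ‖v n x‖ₑ ^ 2) Filter.atTop := by
    filter_upwards [hlim] with x hx
    have h2 : Filter.Tendsto (fun n => ‖v n x‖ₑ ^ 2) Filter.atTop (nhds (‖u x‖ₑ ^ 2)) :=
      ((ENNReal.continuous_pow 2).tendsto _).comp hx.enorm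
    -- Finiteness of $w(x)$ makes multiplication by it continuous, also where the limit is zero.
    exact (ENNReal.Tendsto.const_mul h2 (Or.inr (hwt x))).liminf_eq.symm.le
  refine (lintegral_mono_ae h1).trans ((lintegral_liminf_le' fun n =>
    hw.mul (((hv n).continuous.enorm.measurable.pow_const 2).aemeasurable)).trans ?_)
  have h3 : Filter.Tendsto (fun n => C * K * c n) Filter.atTop
      (nhds (C * K * ∑ i, ∫⁻ x, ‖G i x‖ₑ ^ 2)) :=
    ENNReal.Tendsto.const_mul hc (Or.inr (ENNReal.mul_ne_top hCt hKt))
  rw [← h3.liminf_eq]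
  refine Filter.liminf_le_liminf (Filter.Eventually.of_forall fun n => ?_)
  exact (hC w K hw hK hKt (v n) (hv n) (hvs n)).trans (by gcongr; exact hvc n)

/-- Poincaré's inequality on finitely many disjoint convex cells, for differences. -/
theorem sum_lintegral_sq_sub_le {ι : Type*} {s : Finset ι} {Q : ι → Set R3} {d : ℝ≥0∞}
    (hQ : ∀ k, Convex ℝ (Q k)) (hQm : ∀ k, MeasurableSet (Q k))
    (hQd : Pairwise (Function.onFun Disjoint Q))
    (hd : ∀ k, ∀ x ∈ Q k, ∀ y ∈ Q k, ‖x - y‖ₑ ≤ d) {u : R3 → ℂ} (hu : ContDiff ℝ 1 u) :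
    ∑ k ∈ s, (volume (Q k))⁻¹ * ∫⁻ x in Q k, ∫⁻ y in Q k, ‖u x - u y‖ₑ ^ 2 ≤
      8 * d ^ 2 * ∫⁻ x, ‖fderiv ℝ u x‖ₑ ^ 2 := by
  calc _ ≤ ∑ k ∈ s, 8 * d ^ 2 * ∫⁻ x in Q k, ‖fderiv ℝ u x‖ₑ ^ 2 := by
        refine Finset.sum_le_sum fun k _ => ?_
        calc _ ≤ (volume (Q k))⁻¹ *
              (8 * d ^ 2 * volume (Q k) * ∫⁻ x in Q k, ‖fderiv ℝ u x‖ₑ ^ 2) := by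
              gcongr
              exact lintegral_sq_sub_le (hQ k) (hQm k) (hd k) hu
          _ = ((volume (Q k))⁻¹ * volume (Q k)) *
              (8 * d ^ 2 * ∫⁻ x in Q k, ‖fderiv ℝ u x‖ₑ ^ 2) := by ring
          -- An inequality, because cells of measure zero or infinity are allowed.
          _ ≤ 1 * (8 * d ^ 2 * ∫⁻ x in Q k, ‖fderiv ℝ u x‖ₑ ^ 2) := by
              gcongr
              exact ENNReal.inv_mul_le_one _
          _ = _ := one_mul _
    _ = 8 * d ^ 2 * ∫⁻ x in ⋃ k ∈ s, Q k, ‖fderiv ℝ u x‖ₑ ^ 2 := by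
        rw [← Finset.mul_sum, lintegral_biUnion_finset (fun a _ b _ hab => hQd hab)
          fun k _ => hQm k]
    _ ≤ _ := by
        exact mul_le_mul_right (setLIntegral_le_lintegral _ _) _

/-- Fatou's lemma for differences. -/
theorem lintegral_sq_sub_le_liminf {μ : Measure R3} [SFinite μ] {v : ℕ → R3 → ℂ}
    (hv : ∀ n, Continuous (v n)) {u : R3 → ℂ}
    (hlim : ∀ᵐ x ∂μ, Filter.Tendsto (fun n => v n x) Filter.atTop (nhds (u x))) :
    ∫⁻ x, ∫⁻ y, ‖u x - u y‖ₑ ^ 2 ∂μ ∂μ ≤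
      Filter.liminf (fun n => ∫⁻ x, ∫⁻ y, ‖v n x - v n y‖ₑ ^ 2 ∂μ ∂μ) Filter.atTop := by
  have hm : ∀ n, Measurable fun p : R3 × R3 => ‖v n p.1 - v n p.2‖ₑ ^ 2 := fun n =>
    (((hv n).comp continuous_fst).sub ((hv n).comp continuous_snd)).enorm.measurable.pow_const 2
  have hm1 : ∀ n x, Measurable fun y => ‖v n x - v n y‖ₑ ^ 2 := fun n x =>
    (continuous_const.sub (hv n)).enorm.measurable.pow_const 2
  have hm2 : ∀ n, Measurable fun x => ∫⁻ y, ‖v n x - v n y‖ₑ ^ 2 ∂μ := fun n =>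
    (hm n).lintegral_prod_right'
  refine le_trans ?_ (lintegral_liminf_le hm2)
  refine lintegral_mono_ae ?_
  filter_upwards [hlim] with x hx
  refine le_trans ?_ (lintegral_liminf_le fun n => hm1 n x)
  refine lintegral_mono_ae ?_
  filter_upwards [hlim] with y hy
  have h2 : Filter.Tendsto (fun n => ‖v n x - v n y‖ₑ ^ 2) Filter.atTop
      (nhds (‖u x - u y‖ₑ ^ 2)) :=
    ((ENNReal.continuous_pow 2).tendsto _).comp (hx.sub hy).enorm
  exact h2.liminf_eq.symm.le

/-- Fatou's lemma is applied to the whole sum over the cells, which keeps the constant independent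
of their number. -/
theorem sum_lintegral_sq_sub_le_sobolev {ι : Type*} {s : Finset ι} {Q : ι → Set R3} {d : ℝ≥0∞}
    (hQ : ∀ k, Convex ℝ (Q k)) (hQm : ∀ k, MeasurableSet (Q k))
    (hQd : Pairwise (Function.onFun Disjoint Q)) (hdt : d ≠ ⊤)
    (hd : ∀ k, ∀ x ∈ Q k, ∀ y ∈ Q k, ‖x - y‖ₑ ≤ d) {u : L2} {G : Fin 3 → L2}
    (hG : HasWeakGradient u G) :
    ∑ k ∈ s, (volume (Q k))⁻¹ * ∫⁻ x in Q k, ∫⁻ y in Q k, ‖u x - u y‖ₑ ^ 2 ≤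
      8 * d ^ 2 * ∑ i, ∫⁻ x, ‖G i x‖ₑ ^ 2 := by
  obtain ⟨v, c, hv, hvs, hlim, hvc, hc⟩ := exists_smooth_approx hG
  have hfat : ∀ k, ∫⁻ x in Q k, ∫⁻ y in Q k, ‖u x - u y‖ₑ ^ 2 ≤
      Filter.liminf (fun n => ∫⁻ x in Q k, ∫⁻ y in Q k, ‖v n x - v n y‖ₑ ^ 2) Filter.atTop :=
    fun k => lintegral_sq_sub_le_liminf (fun n => (hv n).continuous) (ae_restrict_of_ae hlim)
  have hsum : ∑ k ∈ s, (volume (Q k))⁻¹ * ∫⁻ x in Q k, ∫⁻ y in Q k, ‖u x - u y‖ₑ ^ 2 ≤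
      Filter.liminf (fun n => ∑ k ∈ s, (volume (Q k))⁻¹ *
        ∫⁻ x in Q k, ∫⁻ y in Q k, ‖v n x - v n y‖ₑ ^ 2) Filter.atTop := by
    refine le_trans (Finset.sum_le_sum fun k _ => ?_) (sum_liminf_le s _)
    rcases eq_or_ne (volume (Q k)) 0 with h0 | h0
    · simp [Measure.restrict_eq_zero.mpr h0]
    refine (mul_le_mul_right (hfat k) _).trans ?_
    rw [ENNReal.liminf_const_mul_of_ne_top (by simpa using h0)]
  refine hsum.trans ?_
  have h3 : Filter.Tendsto (fun n => 8 * d ^ 2 * c n) Filter.atTop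
      (nhds (8 * d ^ 2 * ∑ i, ∫⁻ x, ‖G i x‖ₑ ^ 2)) :=
    ENNReal.Tendsto.const_mul hc
      (Or.inr (ENNReal.mul_ne_top (by norm_num) (ENNReal.pow_ne_top hdt)))
  rw [← h3.liminf_eq]
  refine Filter.liminf_le_liminf (Filter.Eventually.of_forall fun n => ?_)
  exact (sum_lintegral_sq_sub_le hQ hQm hQd hd (hv n)).trans (by gcongr; exact hvc n)

/-- With mean zero, $u(x)$ is the average over $y\in Q$ of $u(x)-u(y)$; Cauchy-Schwarz does the
rest. -/
theorem lintegral_sq_le_of_integral_eq_zero {Q : Set R3} (hQf : volume Q ≠ ⊤) {u : L2}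
    (h0 : ∫ x in Q, u x = 0) :
    ∫⁻ x in Q, ‖u x‖ₑ ^ 2 ≤ (volume Q)⁻¹ * ∫⁻ x in Q, ∫⁻ y in Q, ‖u x - u y‖ₑ ^ 2 := by
  rcases eq_or_ne (volume Q) 0 with hq | hq
  · simp [Measure.restrict_eq_zero.mpr hq]
  have : IsFiniteMeasure (volume.restrict Q) := ⟨by simpa using hQf.lt_top⟩
  have hint : Integrable u (volume.restrict Q) :=
    ((Lp.memLp u).mono_measure Measure.restrict_le_self).integrable (by norm_num)
  rw [← lintegral_const_mul' _ _ (by simpa using hq)]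
  refine lintegral_mono fun x => ?_
  have h1 : (volume Q).toReal • u x = ∫ y in Q, (u x - u y) := by
    rw [integral_sub (integrable_const _) hint, h0, sub_zero]
    simp [Measure.real]
  have h2 : volume Q * ‖u x‖ₑ ≤ ∫⁻ y in Q, ‖u x - u y‖ₑ := by
    calc volume Q * ‖u x‖ₑ = ‖(volume Q).toReal • u x‖ₑ := by
          rw [enorm_smul, Real.enorm_eq_ofReal ENNReal.toReal_nonneg, ENNReal.ofReal_toReal hQf]
      _ ≤ _ := by rw [h1]; exact enorm_integral_le_lintegral_enorm _
  have hmx : Measurable fun y => ‖u x - u y‖ₑ :=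
    (stronglyMeasurable_const.sub (Lp.stronglyMeasurable u)).enorm
  have h3 := sq_lintegral_mul_le (μ := volume.restrict Q) hmx.aemeasurable
    (aemeasurable_const (b := (1 : ℝ≥0∞)))
  simp only [mul_one, one_pow, lintegral_const, Measure.restrict_apply MeasurableSet.univ,
    Set.univ_inter, one_mul] at h3
  have h4 : volume Q * (volume Q)⁻¹ = 1 := ENNReal.mul_inv_cancel hq hQf
  calc ‖u x‖ₑ ^ 2 = (volume Q * (volume Q)⁻¹) ^ 2 * ‖u x‖ₑ ^ 2 := by rw [h4]; simp
    _ = ((volume Q)⁻¹) ^ 2 * (volume Q * ‖u x‖ₑ) ^ 2 := by ring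
    _ ≤ ((volume Q)⁻¹) ^ 2 * ((∫⁻ y in Q, ‖u x - u y‖ₑ ^ 2) * volume Q) := by
        gcongr
        exact (pow_le_pow_left' h2 2).trans h3
    _ = (volume Q * (volume Q)⁻¹) * ((volume Q)⁻¹ * ∫⁻ y in Q, ‖u x - u y‖ₑ ^ 2) := by ring
    _ = _ := by rw [h4, one_mul]

/-! ### Cubes and the form bound -/

/-- The half-open cubes of side `δ`. -/
def cube (δ : ℝ) (k : Fin 3 → ℤ) : Set R3 := {x | ∀ i, ⌊x i / δ⌋ = k i}

theorem measurableSet_cube (δ : ℝ) (k : Fin 3 → ℤ) : MeasurableSet (cube δ k) := by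
  have : cube δ k = ⋂ i, (fun x : R3 => ⌊x i / δ⌋) ⁻¹' {k i} := by
    ext x
    simp [cube]
  rw [this]
  refine MeasurableSet.iInter fun i => ?_
  have hm : Measurable fun x : R3 => ⌊x i / δ⌋ := Int.measurable_floor.comp (by fun_prop)
  exact hm (measurableSet_singleton _)

theorem pairwise_disjoint_cube (δ : ℝ) : Pairwise (Function.onFun Disjoint (cube δ)) := by
  intro k l hkl
  refine Set.disjoint_left.mpr fun x hx hy => hkl (funext fun i => ?_)
  exact (hx i).symm.trans (hy i)

theorem mem_cube_iff {δ : ℝ} (hδ : 0 < δ) {k : Fin 3 → ℤ} {x : R3} :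
    x ∈ cube δ k ↔ ∀ i, k i * δ ≤ x i ∧ x i < (k i + 1) * δ := by
  simp only [cube, Set.mem_ofPred_eq, Int.floor_eq_iff, le_div_iff₀ hδ, div_lt_iff₀ hδ]

theorem convex_cube {δ : ℝ} (hδ : 0 < δ) (k : Fin 3 → ℤ) : Convex ℝ (cube δ k) := by
  intro x hx y hy a b ha hb hab
  rw [mem_cube_iff hδ] at *
  intro i
  have h := convex_Ico ((k i : ℝ) * δ) ((k i + 1) * δ) (hx i) (hy i) ha hb hab
  simpa using h

theorem enorm_sub_le_of_mem_cube {δ : ℝ} (hδ : 0 < δ) {k : Fin 3 → ℤ} {x y : R3}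
    (hx : x ∈ cube δ k) (hy : y ∈ cube δ k) : ‖x - y‖ₑ ≤ ENNReal.ofReal (2 * δ) := by
  rw [mem_cube_iff hδ] at hx hy
  rw [← ofReal_norm]
  apply ENNReal.ofReal_le_ofReal
  rw [EuclideanSpace.norm_eq]
  apply Real.sqrt_le_iff.mpr
  refine ⟨by positivity, ?_⟩
  have h : ∀ i, ‖(x - y) i‖ ^ 2 ≤ δ ^ 2 := by
    intro i
    have : |x i - y i| ≤ δ := by
      rw [abs_le]
      constructor <;> linarith [hx i, hy i, (hx i).1, (hx i).2, (hy i).1, (hy i).2]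
    simpa using pow_le_pow_left₀ (abs_nonneg _) this 2
  calc _ ≤ ∑ _i : Fin 3, δ ^ 2 := Finset.sum_le_sum fun i _ => h i
    _ ≤ _ := by
      simp only [Finset.sum_const, Finset.card_univ, Fintype.card_fin, nsmul_eq_mul,
        Nat.cast_ofNat]
      -- $3\delta^2\le(2\delta)^2$: the factor 2 replaces the sharp $\sqrt3$.
      nlinarith [sq_nonneg δ]

theorem volume_cube_ne_top {δ : ℝ} (hδ : 0 < δ) (k : Fin 3 → ℤ) : volume (cube δ k) ≠ ⊤ := by
  rcases (cube δ k).eq_empty_or_nonempty with h | ⟨x, hx⟩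
  · simp [h]
  refine ((measure_mono fun y hy => ?_).trans_lt
    (measure_closedBall_lt_top (μ := volume) (x := x) (r := 2 * δ))).ne
  have := enorm_sub_le_of_mem_cube hδ hy hx
  rw [← ofReal_norm, ENNReal.ofReal_le_ofReal_iff (by positivity)] at this
  rwa [mem_closedBall_iff_norm]

theorem exists_cover_cube {δ : ℝ} (hδ : 0 < δ) {S : Set R3} (hS : Bornology.IsBounded S) :
    ∃ s : Finset (Fin 3 → ℤ), S ⊆ ⋃ k ∈ s, cube δ k := by
  obtain ⟨R, hR⟩ := hS.exists_norm_le
  obtain ⟨N, hN⟩ := exists_nat_ge (R / δ + 1)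
  refine ⟨Fintype.piFinset fun _ => Finset.Icc (-N : ℤ) N, fun x hx => ?_⟩
  simp only [Set.mem_iUnion, exists_prop]
  refine ⟨fun i => ⌊x i / δ⌋, ?_, fun i => rfl⟩
  rw [Fintype.mem_piFinset]
  intro i
  have h1 : |x i / δ| ≤ R / δ := by
    rw [abs_div, abs_of_pos hδ]
    gcongr
    exact (PiLp.norm_apply_le x i).trans (hR x hx)
  have h2 := abs_le.mp h1
  rw [Finset.mem_Icc]
  constructor
  · apply Int.le_floor.mpr
    push_cast
    linarith
  · have : ((⌊x i / δ⌋ : ℤ) : ℝ) ≤ N := (Int.floor_le _).trans (by linarith)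
    exact_mod_cast this

/-- For a potential in the class `𝒦₀`, the potential energy is dominated by half the kinetic
energy for functions that have mean zero on finitely many suitable sets. -/
theorem MemKatoZero.exists_form_bound {V : R3 → ℝ} (hV : MemKatoZero V) :
    ∃ (s : Finset (Fin 3 → ℤ)) (Q : (Fin 3 → ℤ) → Set R3),
      (∀ k, MeasurableSet (Q k)) ∧ (∀ k, volume (Q k) ≠ ⊤) ∧
      ∀ (u : L2) (G : Fin 3 → L2), HasWeakGradient u G → (∀ k ∈ s, ∫ x in Q k, u x = 0) →
        ∫⁻ x, ‖V x‖ₑ * ‖u x‖ₑ ^ 2 ≤ 2⁻¹ * ∑ i, ∫⁻ x, ‖G i x‖ₑ ^ 2 := by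
  obtain ⟨C, hCt, hC⟩ := exists_kato_inequality_sobolev
  -- The threshold turns the Kato constant $C$ into $1/4$; $C+1$ is nonzero and can be cancelled.
  obtain ⟨W, ⟨hWm, ⟨B, hB⟩, hWs⟩, hVW⟩ := hV.2 (4 * (C + 1))⁻¹ (by
    simpa using ENNReal.mul_ne_top (by norm_num) (ENNReal.add_ne_top.mpr ⟨hCt, ENNReal.one_ne_top⟩))
  have hB0 : 0 ≤ B := (abs_nonneg _).trans (hB 0)
  -- Poincaré with diameter bound $2\delta$ costs $B\cdot 8(2\delta)^2=32B\delta^2$. As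
  -- $(B+1)\delta=1/128$, this is at most $\delta/4\le 1/4$.
  set δ : ℝ := (128 * (B + 1))⁻¹ with hδd
  have hδ : 0 < δ := by positivity
  obtain ⟨s, hs⟩ := exists_cover_cube hδ hWs.isCompact.isBounded
  refine ⟨s, cube δ, measurableSet_cube δ, volume_cube_ne_top hδ, fun u G hG h0 => ?_⟩
  set E := ∑ i, ∫⁻ x, ‖G i x‖ₑ ^ 2 with hE
  have hsmall : ∫⁻ x, ‖V x - W x‖ₑ * ‖u x‖ₑ ^ 2 ≤ 4⁻¹ * E := by
    refine (hC (fun x => ‖V x - W x‖ₑ) (globalKatoNorm (V - W)) (hV.1.sub hWm).enorm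
      (fun x => enorm_ne_top) (fun x => ?_) hVW.ne_top u G hG).trans ?_
    · exact le_iSup (fun x : R3 => ∫⁻ y : R3, ‖(V - W) y‖ₑ / ‖x - y‖ₑ) x
    · gcongr
      calc C * globalKatoNorm (V - W) ≤ (C + 1) * (4 * (C + 1))⁻¹ := by
            gcongr
            exact le_self_add
        _ = (C + 1) * (C + 1)⁻¹ * 4⁻¹ := by
            rw [ENNReal.mul_inv (by simp) (by simp)]
            ring
        _ = 4⁻¹ := by
            rw [ENNReal.mul_inv_cancel (by simp)
              (ENNReal.add_ne_top.mpr ⟨hCt, ENNReal.one_ne_top⟩), one_mul]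
  have hbdd : ∫⁻ x, ‖W x‖ₑ * ‖u x‖ₑ ^ 2 ≤ 4⁻¹ * E := by
    calc _ ≤ ∫⁻ x in ⋃ k ∈ s, cube δ k, ENNReal.ofReal B * ‖u x‖ₑ ^ 2 := by
          rw [← lintegral_indicator (Finset.measurableSet_biUnion s fun k _ =>
            measurableSet_cube δ k)]
          refine lintegral_mono fun x => ?_
          by_cases hx : x ∈ ⋃ k ∈ s, cube δ k
          · rw [Set.indicator_of_mem hx, ← ofReal_norm (W x)]
            gcongr
            exact hB x
          · have : W x = 0 := image_eq_zero_of_notMem_tsupport fun h => hx (hs h)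
            simp [this]
      _ = ENNReal.ofReal B * ∑ k ∈ s, ∫⁻ x in cube δ k, ‖u x‖ₑ ^ 2 := by
          rw [lintegral_const_mul' _ _ ENNReal.ofReal_ne_top, lintegral_biUnion_finset
            (fun a _ b _ hab => pairwise_disjoint_cube δ hab) fun k _ => measurableSet_cube δ k]
      _ ≤ ENNReal.ofReal B * (8 * ENNReal.ofReal (2 * δ) ^ 2 * E) := by
          gcongr
          refine (Finset.sum_le_sum fun k hk => lintegral_sq_le_of_integral_eq_zero
            (volume_cube_ne_top hδ k) (h0 k hk)).trans ?_
          exact sum_lintegral_sq_sub_le_sobolev (convex_cube hδ) (measurableSet_cube δ)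
            (pairwise_disjoint_cube δ) ENNReal.ofReal_ne_top
            (fun k x hx y hy => enorm_sub_le_of_mem_cube hδ hx hy) hG
      _ = ENNReal.ofReal (B * (8 * (2 * δ) ^ 2)) * E := by
          rw [ENNReal.ofReal_mul hB0, ← ENNReal.ofReal_pow (by positivity),
            ENNReal.ofReal_mul (p := 8) (by norm_num), ENNReal.ofReal_ofNat]
          ring
      _ ≤ _ := by
          gcongr
          rw [show (4⁻¹ : ℝ≥0∞) = ENNReal.ofReal 4⁻¹ by
            rw [ENNReal.ofReal_inv_of_pos (by norm_num), ENNReal.ofReal_ofNat]]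
          apply ENNReal.ofReal_le_ofReal
          have h1 : (B + 1) * δ = 1 / 128 := by
            rw [hδd]
            field_simp
          nlinarith
  calc _ ≤ ∫⁻ x, (‖V x - W x‖ₑ * ‖u x‖ₑ ^ 2 + ‖W x‖ₑ * ‖u x‖ₑ ^ 2) := by
        refine lintegral_mono fun x => ?_
        rw [← add_mul]
        gcongr
        simpa using enorm_add_le (V x - W x) (W x)
    _ = (∫⁻ x, ‖V x - W x‖ₑ * ‖u x‖ₑ ^ 2) + ∫⁻ x, ‖W x‖ₑ * ‖u x‖ₑ ^ 2 :=
        lintegral_add_right' _ (hWm.enorm.mul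
          ((Lp.stronglyMeasurable u).enorm.pow_const 2).aemeasurable)
    _ ≤ 4⁻¹ * E + 4⁻¹ * E := add_le_add hsmall hbdd
    _ = _ := by
        rw [← add_mul]
        congr 1
        rw [← two_mul, show (4 : ℝ≥0∞) = 2 * 2 by norm_num,
          ENNReal.mul_inv (by simp) (by simp), ← mul_assoc,
          ENNReal.mul_inv_cancel (by simp) (by simp), one_mul]

/-! ### Negative eigenvalues -/

theorem lintegral_sq_enorm_L2 (g : L2) : ∫⁻ x, ‖g x‖ₑ ^ 2 = ENNReal.ofReal (‖g‖ ^ 2) := by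
  rw [lintegral_sq_enorm_eq, ENNReal.ofReal_pow (norm_nonneg _), Lp.norm_def,
    ENNReal.ofReal_toReal (Lp.memLp g).2.ne]

/-- The form is nonnegative where the potential energy is form-bounded by the kinetic energy. -/
theorem SchrodingerEq.re_inner_nonneg {V : R3 → ℝ} {u f : L2} (h : SchrodingerEq V u f)
    (hb : ∀ G : Fin 3 → L2, HasWeakGradient u G →
      ∫⁻ x, ‖V x‖ₑ * ‖u x‖ₑ ^ 2 ≤ 2⁻¹ * ∑ i, ∫⁻ x, ‖G i x‖ₑ ^ 2) :
    0 ≤ (⟪u, f⟫_ℂ).re := by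
  obtain ⟨G, hG, h⟩ := h
  obtain ⟨-, e⟩ := h u G hG
  have hV := hb G hG
  simp_rw [lintegral_sq_enorm_L2] at hV
  rw [← ENNReal.ofReal_sum_of_nonneg fun i _ => by positivity,
    show (2⁻¹ : ℝ≥0∞) = ENNReal.ofReal 2⁻¹ by
      rw [ENNReal.ofReal_inv_of_pos (by norm_num), ENNReal.ofReal_ofNat],
    ← ENNReal.ofReal_mul (by positivity)] at hV
  have hI : ‖∫ x, (V x : ℂ) * u x * starRingEnd ℂ (u x)‖ ≤ 2⁻¹ * ∑ i, ‖G i‖ ^ 2 := by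
    rw [← ENNReal.ofReal_le_ofReal_iff (by positivity), ofReal_norm]
    refine (enorm_integral_le_lintegral_enorm _).trans (le_trans (le_of_eq ?_) hV)
    refine lintegral_congr fun x => ?_
    rw [enorm_mul, enorm_mul, sq, ← mul_assoc]
    congr 1
    · congr 1
      simp [← ofReal_norm]
    · simp [← ofReal_norm]
  have hS : 0 ≤ ∑ i, ‖G i‖ ^ 2 := by positivity
  rw [← e, Complex.add_re, Complex.re_sum]
  have hn : ∀ i, (⟪G i, G i⟫_ℂ).re = ‖G i‖ ^ 2 := fun i => by
    simpa using inner_self_eq_norm_sq (𝕜 := ℂ) (G i)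
  simp_rw [hn]
  have hre := (abs_le.mp ((Complex.abs_re_le_norm _).trans hI)).1
  linarith

/-- Eigenfunctions to different eigenvalues are orthogonal. -/
theorem SchrodingerEq.inner_eq_zero {V : R3 → ℝ} {ψ φ : L2} {l m : ℝ}
    (hψ : SchrodingerEq V ψ ((l : ℂ) • ψ)) (hφ : SchrodingerEq V φ ((m : ℂ) • φ)) (hlm : l ≠ m) :
    ⟪φ, ψ⟫_ℂ = 0 := by
  obtain ⟨G, hG, h⟩ := hψ
  obtain ⟨K, hK, h'⟩ := hφ
  obtain ⟨-, e⟩ := h φ K hK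
  obtain ⟨-, e'⟩ := h' ψ G hG
  -- The form is Hermitian and the eigenvalues are real: the conjugate of the second equation has
  -- the same left-hand side as the first.
  have e2 := congrArg (starRingEnd ℂ) e'
  rw [map_add, map_sum, ← integral_conj] at e2
  simp only [inner_conj_symm, map_mul, Complex.conj_ofReal, Complex.conj_conj, inner_smul_right]
    at e e2
  have e3 : ∫ x, (V x : ℂ) * starRingEnd ℂ (φ x) * ψ x =
      ∫ x, (V x : ℂ) * ψ x * starRingEnd ℂ (φ x) := by
    congr 1
    ext x
    ring
  rw [e3, e] at e2
  have h4 : ((l : ℂ) - m) * ⟪φ, ψ⟫_ℂ = 0 := by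
    rw [sub_mul, e2, sub_self]
  rcases mul_eq_zero.mp h4 with h5 | h5
  · exact absurd (by exact_mod_cast sub_eq_zero.mp h5) hlm
  · exact h5

/-- A sum of eigenfunctions to different negative eigenvalues on which the form is nonnegative
is trivial. -/
theorem eigenfunctions_eq_zero {V : R3 → ℝ} {ι : Type*} {t : Finset ι} {l : ι → ℝ} {ψ : ι → L2}
    (hl : ∀ i ∈ t, l i < 0) (hinj : Function.Injective l)
    (hψ : ∀ i ∈ t, SchrodingerEq V (ψ i) ((l i : ℂ) • ψ i))
    (hb : ∀ G : Fin 3 → L2, HasWeakGradient (∑ i ∈ t, ψ i) G →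
      ∫⁻ x, ‖V x‖ₑ * ‖(∑ i ∈ t, ψ i : L2) x‖ₑ ^ 2 ≤ 2⁻¹ * ∑ i, ∫⁻ x, ‖G i x‖ₑ ^ 2) :
    ∀ i ∈ t, ψ i = 0 := by
  have hmem : SchrodingerEq V (∑ i ∈ t, ψ i) (∑ i ∈ t, (l i : ℂ) • ψ i) := by
    have := Submodule.sum_mem (schrodingerGraph V) (t := t)
      (f := fun i => (ψ i, (l i : ℂ) • ψ i)) fun i hi => hψ i hi
    have h2 : (∑ i ∈ t, (ψ i, (l i : ℂ) • ψ i)) = (∑ i ∈ t, ψ i, ∑ i ∈ t, (l i : ℂ) • ψ i) :=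
      Prod.ext (by simp [Prod.fst_sum]) (by simp [Prod.snd_sum])
    rw [h2] at this
    exact this
  have h0 := hmem.re_inner_nonneg hb
  -- Orthogonality removes the cross terms, leaving a sum of nonpositive terms that must be
  -- nonnegative.
  have hin : (⟪∑ i ∈ t, ψ i, ∑ i ∈ t, (l i : ℂ) • ψ i⟫_ℂ).re = ∑ i ∈ t, l i * ‖ψ i‖ ^ 2 := by
    rw [sum_inner, Complex.re_sum]
    refine Finset.sum_congr rfl fun i hi => ?_
    rw [inner_sum, Finset.sum_eq_single i]
    · rw [inner_smul_right, Complex.re_ofReal_mul]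
      congr 1
      simpa using inner_self_eq_norm_sq (𝕜 := ℂ) (ψ i)
    · intro j hj hji
      rw [inner_smul_right, (hψ j hj).inner_eq_zero (hψ i hi) (hinj.ne hji), mul_zero]
    · exact fun h => absurd hi h
  rw [hin] at h0
  have hnp : ∀ i ∈ t, l i * ‖ψ i‖ ^ 2 ≤ 0 := fun i hi =>
    mul_nonpos_of_nonpos_of_nonneg (hl i hi).le (by positivity)
  have hz := (Finset.sum_eq_zero_iff_of_nonpos hnp).mp (le_antisymm (Finset.sum_nonpos hnp) h0)
  intro i hi
  have := (mul_eq_zero.mp (hz i hi)).resolve_left (hl i hi).ne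
  simpa using this

theorem schrodingerEq_of_mem_eigenspace {V : R3 → ℝ} {μ : ℂ}
    {ψ : (schrodingerOperator V).domain} (h : ψ ∈ eigenspace (schrodingerOperator V) μ) :
    SchrodingerEq V ψ (μ • (ψ : L2)) := by
  have h1 : (schrodingerOperator V) ψ = μ • (ψ : L2) := by
    have := LinearMap.mem_ker.mp h
    rw [LinearMap.sub_apply, sub_eq_zero] at this
    exact this
  rw [← mem_graph_schrodingerOperator, ← h1]
  exact LinearPMap.mem_graph _ ψ

/-- The averages over finitely many sets of finite measure, as a linear map on `L²`. -/
theorem exists_averages {ι : Type*} (s : Finset ι) {Q : ι → Set R3}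
    (hQ : ∀ k, MeasurableSet (Q k)) (hQf : ∀ k, volume (Q k) ≠ ⊤) :
    ∃ A : L2 →ₗ[ℂ] (s → ℂ), ∀ u, A u = 0 → ∀ k ∈ s, ∫ x in Q k, u x = 0 := by
  refine ⟨LinearMap.pi fun k : s =>
    (innerSL ℂ (indicatorConstLp 2 (hQ k) (hQf k) (1 : ℂ))).toLinearMap, fun u hu k hk => ?_⟩
  have := congrFun hu ⟨k, hk⟩
  rw [← L2.inner_indicatorConstLp_one (𝕜 := ℂ) (hQ k) (hQf k) u]
  exact this

/-- A potential in the class `𝒦₀` has at most finitely many negative eigenvalues, each of finite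
multiplicity. This needs no assumption on resonances. -/
theorem finite_negative_eigenvalues {V : R3 → ℝ} (hV : MemKatoZero V) :
    {l : ℝ | l < 0 ∧ IsEigenvalue (schrodingerOperator V) (l : ℂ)}.Finite ∧
      ∀ l : ℝ, l < 0 → FiniteDimensional ℂ (eigenspace (schrodingerOperator V) (l : ℂ)) := by
  obtain ⟨s, Q, hQ, hQf, hb⟩ := hV.exists_form_bound
  obtain ⟨A, hA⟩ := exists_averages s hQ hQf
  constructor
  · set S := {l : ℝ | l < 0 ∧ IsEigenvalue (schrodingerOperator V) (l : ℂ)}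
    have hex : ∀ l : S, ∃ ψ : L2, SchrodingerEq V ψ (((l : ℝ) : ℂ) • ψ) ∧ ψ ≠ 0 := by
      rintro ⟨l, -, hl⟩
      obtain ⟨ψ, hψ, hψ0⟩ := Submodule.exists_mem_ne_zero_of_ne_bot hl
      exact ⟨ψ, schrodingerEq_of_mem_eigenspace hψ, by simpa using hψ0⟩
    choose ψ hψ hψ0 using hex
    -- In a vanishing combination of the averages, each $g_i\psi_i$ still solves the eigenvalue
    -- equation, so it is zero. Independence in the space of functions on `s` bounds the number of
    -- eigenvalues.
    have hli : LinearIndependent ℂ fun l : S => A (ψ l) := by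
      rw [linearIndependent_iff']
      intro t g hg i hi
      have hz : A (∑ i ∈ t, g i • ψ i) = 0 := by simpa [map_sum] using hg
      have := eigenfunctions_eq_zero (V := V) (t := t) (l := fun i : S => (i : ℝ))
        (ψ := fun i => g i • ψ i) (fun i _ => i.2.1) Subtype.val_injective
        (fun i _ => by
          rw [smul_comm]
          have hm : (ψ i, ((i : ℝ) : ℂ) • ψ i) ∈ schrodingerGraph V := hψ i
          exact (schrodingerGraph V).smul_mem (g i) hm)
        (fun G hG => hb _ G hG (hA _ hz)) i hi
      exact (smul_eq_zero.mp this).resolve_right (hψ0 i)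
    have := hli.finite
    exact Set.toFinite S
  · intro l hl
    refine FiniteDimensional.of_injective (A ∘ₗ (schrodingerOperator V).domain.subtype ∘ₗ
      (eigenspace (schrodingerOperator V) (l : ℂ)).subtype) ?_
    rw [← LinearMap.ker_eq_bot, LinearMap.ker_eq_bot']
    intro ψ hψ
    -- A single eigenfunction, as a family indexed by `Unit`: the averages are injective on the
    -- eigenspace.
    have hz := eigenfunctions_eq_zero (V := V) (t := Finset.univ) (l := fun _ : Unit => l)
      (ψ := fun _ => ((ψ : (schrodingerOperator V).domain) : L2)) (fun _ _ => hl)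
      (Function.injective_of_subsingleton _) (fun _ _ => schrodingerEq_of_mem_eigenspace ψ.2)
      (fun G hG => hb _ G hG (hA _ (by simpa using hψ))) () (Finset.mem_univ _)
    simpa using hz

end SchrodingerKato

theorem lemma2p6 (V : SchrodingerKato.R3 → ℝ)
    (hV : SchrodingerKato.MemKatoZero V)
    (h0 : ¬ SchrodingerKato.IsResonance V 0) :
    {l : ℝ | l < 0 ∧
        SchrodingerKato.IsEigenvalue (SchrodingerKato.schrodingerOperator V) (l : ℂ)}.Finite ∧
      ∀ l : ℝ, l < 0 →
        FiniteDimensional ℂ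
          (SchrodingerKato.eigenspace (SchrodingerKato.schrodingerOperator V) (l : ℂ)) :=
  SchrodingerKato.finite_negative_eigenvalues hV
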